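/- **Setting.** Let $p$ be an odd prime and let $N$ be a positive integer with $N<p$ (the size of a quorum $P_1,\dots,P_N$). Put $d=\lfloor N/3\rfloor$. A vector $\langle a\rangle=(a_1,\dots,a_N)\in\mathbb Z_p^N$ is a *sharing* of $a\in\mathbb Z_p$ if there is a polynomial $\varphi$ over $\mathbb Z_p$ of degree at most $d$ with $\varphi(0)=a$ and $\varphi(i)=a_i$ for all $i$. Elements of $\mathbb Z_p$ are compared through their representatives in $\{0,\dots,p-1\}$. The parties have synchronous private authenticated channels. A static set of at most $N/6$ of the parties is dishonest and controlled by an active, rushing, computationally unbounded adversary, whose moves are arbitrary functions of everything seen so far. **Subprotocols.** Dealing a polynomial is by verifiable secret sharing, used as a primitive: an honest dealer's coefficients are uniformly random; a dishonest dealer is bound to a polynomial of the prescribed degree bound (and prescribed secret $0$, where applicable), which he may choose after seeing the dishonest parties' shares of the honest dealings of that round; a disqualified dealer counts as dealing the zero polynomial. All else is built from dealings and messages. * $\mathsf{GenRand}$ of degree $k$: every party deals a polynomial of degree at most $k$ and the received shares are added. * $\mathsf{RenewShares}(\langle a\rangle)$: every party deals a polynomial of degree at most $d$ with value $0$ at $0$,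 and the received shares are added to $\langle a\rangle$. * $\mathsf{Reconst}$: honest parties send their shares to all; dishonest parties send anything, possibly different values to different parties; each honest party decodes, correcting up to $\lfloor (N-d-1)/2\rfloor$ errors. The run *fails* if the honest parties obtain different values. * $\mathsf{Multiply}(\langle a\rangle,\langle b\rangle)$: generate $\langle u\rangle,\langle v\rangle$ by $\mathsf{GenRand}$ of degree $\lfloor N/6\rfloor$, form $w_i=u_iv_i$, apply $\mathsf{RenewShares}$ to $\langle u\rangle,\langle v\rangle,\langle w\rangle$, reconstruct $\varepsilon=a+u$ and $\delta=b+v$, and output $c_i=w_i+\delta a_i+\varepsilon b_i-\varepsilon\delta$. * $\mathsf{Compare}(\langle a\rangle,\langle b\rangle)$, outputting a sharing of $\rho=(a\le b)\in\{0,1\}$: the comparison of Nishide and Ohta, $(a\le b)=1-(b<a)$, where $(a<b)=w(x+y-2xy)+1-y-x+xy$ for the bits $w=(a<p/2)$, $x=(b<p/2)$, $y=((a-b)\bmod p<p/2)$. The bit $(z<p/2)$ is one minus the least significant bit of $2z\bmod p$; the least significant bit of a shared $t$ is found by reconstructing $c=t+r$ for a random $r\in\{0,\dots,p-1\}$ shared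 bit by bit, as the exclusive or of $(c<r)$ and the lowest bits of $c$ and $r$. Bitwise comparison with a public number uses the most significant differing bit, found by disjunctions computed with $\mathsf{Multiply}$ from the top bit downwards. A random bit is $(r/\sqrt{r^2}+1)/2$ for random shared $r$ with $r^2$ reconstructed, repeated if $r^2=0$; a bitwise shared random number is redrawn if it is not less than $p$. Each such repetition is attempted at most $K$ times, after which the run fails. **Gate computation.** On sharings $\langle r\rangle,\langle x\rangle,\langle r'\rangle,\langle x'\rangle$ the parties compute $\langle\rho\rangle=\mathsf{Compare}(\langle r\rangle,\langle r'\rangle)$ and $$\langle s\rangle=\langle\rho\rangle\langle r\rangle+(1-\langle\rho\rangle)\langle r'\rangle,\qquad \langle s'\rangle=\langle\rho\rangle\langle r'\rangle+(1-\langle\rho\rangle)\langle r\rangle,$$ $$\langle y\rangle=\langle\rho\rangle\langle x\rangle+(1-\langle\rho\rangle)\langle x'\rangle,\qquad \langle y'\rangle=\langle\rho\rangle\langle x'\rangle+(1-\langle\rho\rangle)\langle x\rangle,$$ every product being computed by $\mathsf{Multiply}$. **Lemma (the gate computation obliviously swaps pairs).** For every such adversary, every $K$, and every view of the adversary before the step: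 1. On input sharings of $r,x,r',x'$, in every run that does not fail the outputs $\langle s\rangle,\langle y\rangle,\langle s'\rangle,\langle y'\rangle$ are sharings of $r,x,r',x'$ respectively if $r\le r'$, and of $r',x',r,x$ respectively otherwise. 2. The probability that a run fails tends to $0$ as $K\to\infty$, uniformly in the adversary, the earlier view and the input sharings ($p$ and $N$ being fixed). 3. The joint law of everything the adversary obtains (its view of the step, the dishonest parties' shares of the outputs, and whether the run fails) depends on the input sharings only through the dishonest parties' input shares: it is the same for any two quadruples of input sharings, of possibly different secrets, in which the dishonest parties hold the same shares. 4. If the inputs are shared by independent random polynomials of degree at most $d$, then the joint law of everything the adversary obtains, now including the dishonest parties' input shares, is the same for all secrets $(r,x),(r',x')$. In particular it is unchanged if the two input pairs are exchanged, so the adversary remains oblivious of which output pair is mapped to the first (second) input pair. -/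

import Mathlib

noncomputable section

namespace ObliviousGate

/-! A quorum consists of the parties `i : Fin N`; party `i` owns the evaluation point `i + 1` of the
field `ZMod p`. Communication is synchronous over private authenticated channels. A static set of
parties is controlled by an active, rushing, computationally unbounded adversary. -/

/-- A shared value `⟨a⟩ = (a_1, …, a_N)`: the vector of the shares of all parties. -/
abbrev Shares (p N : ℕ) : Type := Fin N → ZMod p

/-- The evaluation point of a party. -/
def point (p : ℕ) {N : ℕ} (i : Fin N) : ZMod p := ((i.val + 1 : ℕ) : ZMod p)

/-- What the adversary gets to see: shares held by the dishonest parties, or the messages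
(sender, receiver) that honest parties send to dishonest ones in one round. All other entries
are masked by `0`. -/
inductive Event (p N : ℕ) : Type
  | held (v : Shares p N)
  | received (m : Fin N → Fin N → ZMod p)

/-- A strategy of the adversary. Its moves are arbitrary functions of everything it has seen so far,
including the honest messages of the current round.

* `deal view j` : the coefficients of the polynomial to which the dishonest dealer `j` commits in a
  verifiable secret sharing (a disqualified dealer counts as dealing the zero polynomial);
* `send view i j` : the value that the dishonest party `i` sends to party `j` in a reconstruction. -/
structure Adversary (p N : ℕ) where
  corrupt : Finset (Fin N)
  deal : List (Event p N) → Fin N → ℕ → ZMod p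
  send : List (Event p N) → Fin N → Fin N → ZMod p

/-- The shares held by dishonest parties. -/
def Adversary.seeHeld {p N : ℕ} (A : Adversary p N) (v : Shares p N) : Shares p N :=
  fun i => if i ∈ A.corrupt then v i else 0

/-- The messages that go from honest to dishonest parties. -/
def Adversary.seeSent {p N : ℕ} (A : Adversary p N) (m : Fin N → Fin N → ZMod p) :
    Fin N → Fin N → ZMod p :=
  fun i j => if i ∉ A.corrupt ∧ j ∈ A.corrupt then m i j else 0

/-- A protocol with outcome in `α`: it maps the view of the adversary so far to the joint
distribution of the outcome (`none` if the run failed) and the extended view. -/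
abbrev Proto (p N : ℕ) (α : Type) : Type := OptionT (StateT (List (Event p N)) PMF) α

/-- Execution of a protocol from a given view. -/
def Proto.exec {p N : ℕ} {α : Type} (m : Proto p N α) (view : List (Event p N)) :
    PMF (Option α × List (Event p N)) :=
  StateT.run (OptionT.run m) view

/-- Repeat an attempt until it succeeds, at most `K` times. -/
def retry {p N : ℕ} {α : Type} : ℕ → Proto p N (Option α) → Proto p N α
  | 0, _ => failure
  | K + 1, m => do
    match ← m with
    | some a => pure a
    | none => retry K m

/-- The degree `N / 3` of the polynomials that carry shared values. -/
abbrev deg (N : ℕ) : ℕ := N / 3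

/-- `v` is a sharing of `a`: the shares lie on a polynomial of degree at most `N / 3` with
value `a` at `0`. -/
def IsSharing {p N : ℕ} (v : Shares p N) (a : ZMod p) : Prop :=
  ∃ f : Polynomial (ZMod p), f.natDegree ≤ deg N ∧ f.eval 0 = a ∧ ∀ i, v i = f.eval (point p i)

/-- The shares of `∑_{m ≤ k} c_m X^m`. -/
def sharesOf {p N : ℕ} (k : ℕ) (c : ℕ → ZMod p) : Shares p N :=
  fun i => ∑ m ∈ Finset.range (k + 1), c m * point p i ^ m

/-- The sharing of a constant with which every party starts without communication. -/
def const {p N : ℕ} (a : ZMod p) : Shares p N := fun _ => a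

section Primitives

variable {p N : ℕ} [Fact p.Prime]

/-- Coefficients of the polynomial of one dealer: `c 0, …, c k`, with the constant coefficient
replaced by `0` if `zero` is set (a verified dealing of the secret `0`). -/
def dealtCoeff (zero : Bool) (k : ℕ) (c : Fin (k + 1) → ZMod p) (m : ℕ) : ZMod p :=
  if zero = true ∧ m = 0 then 0 else if h : m < k + 1 then c ⟨m, h⟩ else 0

/-- One round in which every party deals a polynomial of degree at most `k` by verifiable secret
sharing, and the parties add up the shares that they receive. Honest dealers choose uniformly
random coefficients; dishonest dealers choose theirs after having seen their shares of the honest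
dealings, and verification binds them to degree at most `k` (and to the secret `0` if `zero`). -/
def dealAndAdd (A : Adversary p N) (zero : Bool) (k : ℕ) : Proto p N (Shares p N) := do
  let c ← (liftM (PMF.uniformOfFintype (Fin N → Fin (k + 1) → ZMod p)) :
    Proto p N (Fin N → Fin (k + 1) → ZMod p))
  modify fun view => view ++
    [Event.received (A.seeSent fun j i => sharesOf k (dealtCoeff zero k (c j)) i)]
  let view ← get
  let coeff : Fin N → ℕ → ZMod p := fun j =>
    if j ∈ A.corrupt then dealtCoeff zero k (fun m => A.deal view j m)
    else dealtCoeff zero k (c j)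
  pure fun i => ∑ j, sharesOf k (coeff j) i

/-- `GenRand`: a jointly generated random secret on a polynomial of degree `k`. -/
def genRand (A : Adversary p N) (k : ℕ) : Proto p N (Shares p N) := dealAndAdd A false k

/-- `RenewShares`: add a jointly generated random polynomial `δ` of degree `N / 3`
with `δ(0) = 0`. -/
def renewShares (A : Adversary p N) (v : Shares p N) : Proto p N (Shares p N) := do
  let z ← dealAndAdd A true (deg N)
  pure (v + z)

/-- Interpolation with error correction (Berlekamp-Welch): the value at `0` of the polynomial of
degree at most `N / 3` that differs from the received word in at most `(N - N / 3 - 1) / 2` places.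
If all received values are consistent this is the interpolation polynomial. -/
def decode (w : Fin N → ZMod p) : ZMod p := by
  classical
  exact
    if h : ∃ f : Polynomial (ZMod p), f.natDegree ≤ deg N ∧
        (Finset.univ.filter fun i => f.eval (point p i) ≠ w i).card ≤ (N - deg N - 1) / 2
    then h.choose.eval 0 else 0

/-- `Reconst`: every honest party sends its share to all; dishonest parties send anything, possibly
different values to different parties; every honest party decodes what it has received. The run
counts as failed if the honest parties do not all obtain the same value. -/
def reconst (A : Adversary p N) (v : Shares p N) : Proto p N (ZMod p) := by
  classical
  exact do
    modify fun view => view ++ [Event.received (A.seeSent fun i _ => v i)]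
    let view ← get
    let word : Fin N → Fin N → ZMod p := fun j i =>
      if i ∈ A.corrupt then A.send view i j else v i
    if h : ∃ a : ZMod p, ∀ j, j ∉ A.corrupt → decode (word j) = a then pure h.choose else failure

/-- `Multiply`: multiplication by means of a random triple `(u, v, u v)`. -/
def multiply (A : Adversary p N) (a b : Shares p N) : Proto p N (Shares p N) := do
  let u₀ ← genRand A (N / 6)
  let v₀ ← genRand A (N / 6)
  let u ← renewShares A u₀
  let v ← renewShares A v₀
  let w ← renewShares A (u₀ * v₀)
  let ε ← reconst A (a + u)
  let δ ← reconst A (b + v)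
  pure (w + δ • a + ε • b - const (ε * δ))

end Primitives

section Comparison

/-! The comparison protocol of Nishide and Ohta: three tests `z < p / 2`, each of which is the least
significant bit of `2 z`, found by opening `2 z + r` for a bitwise shared random `r`. -/

variable {p N : ℕ} [Fact p.Prime]

/-- The number of binary digits of `p`. -/
abbrev bitLength (p : ℕ) : ℕ := Nat.size p

/-- The square root of a public value in `{0, …, (p - 1) / 2}`. -/
def smallRoot (a : ZMod p) : ZMod p := by
  classical
  exact if h : ∃ s : ZMod p, s.val ≤ p / 2 ∧ s ^ 2 = a then h.choose else 0

/-- A shared random bit: open the square of a random `r`, start again if it is `0`, and otherwise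
take `(r / √(r²) + 1) / 2`. -/
def randBit (A : Adversary p N) (K : ℕ) : Proto p N (Shares p N) :=
  retry K do
    let r ← genRand A (deg N)
    let sq ← multiply A r r
    let a ← reconst A sq
    if a = 0 then pure none
    else pure (some ((2 : ZMod p)⁻¹ • ((smallRoot a)⁻¹ • r + const 1)))

/-- A sharing of `b ⊕ c` for a shared bit `b` and a public bit `c`. -/
def xorPublic (b : Shares p N) (c : Bool) : Shares p N := if c then const 1 - b else b

/-- For shared bits, least significant first, the shared disjunctions of each bit with all more
significant ones. -/
def prefixOr (A : Adversary p N) : List (Shares p N) → Proto p N (List (Shares p N))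
  | [] => pure []
  | c :: cs => do
    match ← prefixOr A cs with
    | [] => pure [c]
    | d :: ds => do
      let m ← multiply A c d
      pure ((c + d - m) :: d :: ds)

/-- The shared indicators of the most significant position in which the shared bits `bs` differ from
the binary digits of the public number `c`. -/
def firstDifference (A : Adversary p N) (bs : List (Shares p N)) (c : ℕ) :
    Proto p N (List (Shares p N)) := do
  let ds ← prefixOr A (bs.mapIdx fun i b => xorPublic b (c.testBit i))
  pure (List.zipWith (fun d e => d - e) ds (ds.tail ++ [const 0]))

/-- A sharing of the bit `b < c` for a bitwise shared `b` and a public `c`. -/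
def ltPublic (A : Adversary p N) (bs : List (Shares p N)) (c : ℕ) : Proto p N (Shares p N) := do
  let es ← firstDifference A bs c
  pure (es.mapIdx fun i e => if c.testBit i then e else const 0).sum

/-- A sharing of the bit `c < b` for a public `c` and a bitwise shared `b`. -/
def publicLt (A : Adversary p N) (c : ℕ) (bs : List (Shares p N)) : Proto p N (Shares p N) := do
  let es ← firstDifference A bs c
  let ms ← (List.zip es bs).mapM fun eb => multiply A eb.1 eb.2
  pure ms.sum

/-- A random element of `{0, …, p - 1}`, shared bit by bit, least significant bit first: draw random
bits, open the bit `r < p`, and start again if it is `0`. -/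
def randBitwise (A : Adversary p N) (K : ℕ) : Proto p N (List (Shares p N)) :=
  retry K do
    let bs ← (List.range (bitLength p)).mapM fun _ => randBit A K
    let l ← ltPublic A bs p
    let ok ← reconst A l
    if ok = 1 then pure (some bs) else pure none

/-- The sharing of `∑ 2^i b_i`. -/
def recompose (bs : List (Shares p N)) : Shares p N :=
  (bs.mapIdx fun i b => (2 : ZMod p) ^ i • b).sum

/-- A sharing of the least significant bit of the representative of `x` in `{0, …, p - 1}`. -/
def leastBit (A : Adversary p N) (K : ℕ) (x : Shares p N) : Proto p N (Shares p N) := do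
  let bs ← randBitwise A K
  let c ← reconst A (x + recompose bs)
  let wrap ← publicLt A c.val bs
  let g := xorPublic (bs.headD (const 0)) (c.val.testBit 0)
  let wg ← multiply A wrap g
  pure (wrap + g - (2 : ZMod p) • wg)

/-- A sharing of the bit `x < p / 2`. -/
def lowerHalf (A : Adversary p N) (K : ℕ) (x : Shares p N) : Proto p N (Shares p N) := do
  let b ← leastBit A K ((2 : ZMod p) • x)
  pure (const 1 - b)

/-- A sharing of the bit `a < b`. -/
def lessThan (A : Adversary p N) (K : ℕ) (a b : Shares p N) : Proto p N (Shares p N) := do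
  let w ← lowerHalf A K a
  let x ← lowerHalf A K b
  let y ← lowerHalf A K (a - b)
  let xy ← multiply A x y
  let t ← multiply A w (x + y - (2 : ZMod p) • xy)
  pure (t + const 1 - y - x + xy)

/-- `Compare`: a sharing of the bit `ρ = (a ≤ b)`. -/
def compare (A : Adversary p N) (K : ℕ) (a b : Shares p N) : Proto p N (Shares p N) := do
  let l ← lessThan A K b a
  pure (const 1 - l)

end Comparison

section Gate

/-- Two pairs `(key₁, msg₁)` and `(key₂, msg₂)` on the two wires of a gate. -/
structure TwoPairs (α : Type) : Type where
  key₁ : α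
  msg₁ : α
  key₂ : α
  msg₂ : α

/-- Apply a function to all four entries. -/
def TwoPairs.map {α β : Type} (f : α → β) (q : TwoPairs α) : TwoPairs β :=
  ⟨f q.key₁, f q.msg₁, f q.key₂, f q.msg₂⟩

/-- Exchange the two pairs. -/
def TwoPairs.swap {α : Type} (q : TwoPairs α) : TwoPairs α := ⟨q.key₂, q.msg₂, q.key₁, q.msg₁⟩

/-- Entrywise: `V` consists of sharings of the entries of `q`. -/
def AreSharings {p N : ℕ} (V : TwoPairs (Shares p N)) (q : TwoPairs (ZMod p)) : Prop :=
  IsSharing V.key₁ q.key₁ ∧ IsSharing V.msg₁ q.msg₁ ∧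
    IsSharing V.key₂ q.key₂ ∧ IsSharing V.msg₂ q.msg₂

variable {p N : ℕ} [Fact p.Prime]

/-- The gate computation: `ρ = (r ≤ r')`, then `s = ρ r + (1 - ρ) r'`, `y = ρ x + (1 - ρ) x'`,
`s' = ρ r' + (1 - ρ) r`, `y' = ρ x' + (1 - ρ) x`, with every product computed by `multiply`. -/
def gate (A : Adversary p N) (K : ℕ) (V : TwoPairs (Shares p N)) :
    Proto p N (TwoPairs (Shares p N)) := do
  let ρ ← compare A K V.key₁ V.key₂
  let select : Shares p N → Shares p N → Proto p N (Shares p N) := fun a b => do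
    let m₁ ← multiply A ρ a
    let m₂ ← multiply A (const 1 - ρ) b
    pure (m₁ + m₂)
  let s ← select V.key₁ V.key₂
  let y ← select V.msg₁ V.msg₂
  let s' ← select V.key₂ V.key₁
  let y' ← select V.msg₂ V.msg₁
  pure ⟨s, y, s', y'⟩

/-- The law of all that the adversary has after the gate computation on the sharings `V`: whether the
run failed, the output shares of the dishonest parties, and the whole view. -/
def adversaryLaw (A : Adversary p N) (K : ℕ) (view : List (Event p N))
    (V : TwoPairs (Shares p N)) :
    PMF (Option (TwoPairs (Shares p N)) × List (Event p N)) :=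
  ((gate A K V).exec view).map fun z => (z.1.map fun out => out.map A.seeHeld, z.2)

/-- A random sharing of `a`: a polynomial of degree at most `N / 3` with constant coefficient `a`
and all other coefficients uniformly random. -/
def shareRandomly (N : ℕ) (a : ZMod p) : PMF (Shares p N) :=
  (PMF.uniformOfFintype (Fin (deg N) → ZMod p)).map fun c =>
    sharesOf (deg N) fun m =>
      if m = 0 then a else if h : m - 1 < deg N then c ⟨m - 1, h⟩ else 0

/-- The law of all that the adversary has after a gate computation on independent random sharings of
the secret inputs `q`, including the dishonest parties' shares of the inputs. -/
def adversaryLawOfSecrets (A : Adversary p N) (K : ℕ) (view : List (Event p N))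
    (q : TwoPairs (ZMod p)) :
    PMF (Option (TwoPairs (Shares p N)) × List (Event p N)) := do
  let vr ← shareRandomly N q.key₁
  let vx ← shareRandomly N q.msg₁
  let vr' ← shareRandomly N q.key₂
  let vx' ← shareRandomly N q.msg₂
  adversaryLaw A K
    (view ++ [.held (A.seeHeld vr), .held (A.seeHeld vx),
      .held (A.seeHeld vr'), .held (A.seeHeld vx')])
    ⟨vr, vx, vr', vx'⟩

end Gate

end ObliviousGate

end

set_option linter.unusedSectionVars false

noncomputable section

namespace ObliviousGate

/-! ### Weighted expectations and the two program judgements -/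

section Calculus

variable {p N : ℕ} {α β γ δ : Type}

/-! Secrecy rests on one principle: two runs whose inputs agree on the dishonest shares can be
coupled so that the adversary's views coincide throughout. `Rel` expresses such a coupling by
inequalities between expectations. The hypotheses are symmetric in the two runs, so exchanging them
turns the final inequality into equality of laws. `Ensures` treats correctness and failure together:
a wrong outcome costs `⊤` and a failed run costs `1`, so a finite bound on the expected cost
excludes the former and bounds the probability of the latter.

The source of secrecy is a polynomial invisible to the adversary: a multiple of `∏ (1 - X / x_j)`
over the dishonest points `x_j` has any desired value at `0`, vanishes at these points and has
degree at most `N / 6` (`exists_hidden`). Adding it to the dealing of one honest party permutes that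
party's uniform coefficients and leaves the view unchanged (`rel_dealAndAdd`). Opening a value shows
the adversary all honest shares, so a coupling must make the opened vectors equal, not merely their
secrets. In `rel_multiply` the masks absorb the differences of the factors, and the renewal of their
product still allows any prescribed invisible shift of the output.

The delicate opening is that of the bit `r < p`, whose sharing is not renewed beforehand. The
product formed at the lowest digit supplies the randomness: `p` is odd, so the disjunction at this
digit enters the result with coefficient one (`rel_prefixOr_head`, `rel_ltPublic`). For repeated
attempts the useful invariant is pointwise: sharings of bits with equal dishonest shares are equally
likely for each final view (`exec_bitAttempt_le`). This passes through repetition and lists and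
yields the same for digit lists of numbers below `p` (`exec_randBitwise_le`). `rel_of_exchangeable`
turns it back into couplings, and `rel_randBitwise` chooses one in which two different secrets are
masked to the same vector. The rest of the gate consists of linear operations and products.

Decoding always succeeds, so only exhausted repetitions cause failure. An attempt is rejected with
probability at most `1 / 2`: shifting a random value by `1` leaves the event `r = 0`, and flipping
the top digit leaves the event `r ≥ p`. The total bound is a constant times `2⁻¹ ^ K`, independent
of the adversary, the view and the inputs. -/

/-- Expectation of a nonnegative function. -/
def expect (μ : PMF α) (F : α → ENNReal) : ENNReal := ∑' a, μ a * F a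

theorem expect_pure (a : α) (F : α → ENNReal) : expect (PMF.pure a) F = F a := by
  classical
  rw [expect, tsum_eq_single a]
  · simp
  · intro b hb; simp [PMF.pure_apply, hb]

theorem expect_bind (μ : PMF α) (f : α → PMF β) (F : β → ENNReal) :
    expect (μ.bind f) F = expect μ fun a => expect (f a) F := by
  simp only [expect, PMF.bind_apply, ← ENNReal.tsum_mul_right, ← ENNReal.tsum_mul_left]
  rw [ENNReal.tsum_comm]
  simp only [mul_assoc]

theorem expect_map (μ : PMF α) (f : α → β) (F : β → ENNReal) :
    expect (μ.map f) F = expect μ fun a => F (f a) := by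
  rw [← PMF.bind_pure_comp, expect_bind]
  simp [expect_pure]

theorem expect_mono (μ : PMF α) {F G : α → ENNReal} (h : ∀ a, F a ≤ G a) :
    expect μ F ≤ expect μ G :=
  ENNReal.tsum_le_tsum fun a => mul_le_mul_right (h a) _

theorem expect_add (μ : PMF α) (F G : α → ENNReal) :
    (expect μ fun a => F a + G a) = expect μ F + expect μ G := by
  simp only [expect, mul_add, ENNReal.tsum_add]

theorem expect_const (μ : PMF α) (c : ENNReal) : (expect μ fun _ => c) = c := by
  simp [expect, ENNReal.tsum_mul_right, PMF.tsum_coe]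

theorem expect_mul (μ : PMF α) (c : ENNReal) (F : α → ENNReal) :
    (expect μ fun a => c * F a) = c * expect μ F := by
  simp only [expect, ← ENNReal.tsum_mul_left]
  exact tsum_congr fun a => by ring

theorem expect_single [DecidableEq α] (μ : PMF α) (a : α) :
    (expect μ fun b => if b = a then 1 else 0) = μ a := by
  rw [expect, tsum_eq_single a]
  · simp
  · intro b hb; simp [hb]

theorem expect_uniform_comp_equiv [Fintype α] [Nonempty α] (e : α ≃ α) (F : α → ENNReal) :
    (expect (PMF.uniformOfFintype α) fun a => F (e a)) = expect (PMF.uniformOfFintype α) F := by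
  simp only [expect, PMF.uniformOfFintype_apply]
  exact e.tsum_eq (fun a => _ * F a)

/-- Expectation of a function of outcome and final view of a protocol. -/
def wp (m : Proto p N α) (view : List (Event p N))
    (F : Option α → List (Event p N) → ENNReal) : ENNReal :=
  expect (m.exec view) fun z => F z.1 z.2

/-- Extend a post-expectation along the continuation of a bind. -/
def wpBind (f : α → Proto p N β) (F : Option β → List (Event p N) → ENNReal) :
    Option α → List (Event p N) → ENNReal
  | none, view => F none view
  | some a, view => wp (f a) view F

theorem exec_bind (m : Proto p N α) (f : α → Proto p N β) (view : List (Event p N)) :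
    (m >>= f).exec view = (m.exec view).bind fun z =>
      match z.1 with
      | none => PMF.pure (none, z.2)
      | some a => (f a).exec z.2 := by
  refine congrArg (PMF.bind (m.exec view)) (funext fun z => ?_)
  rcases z with ⟨_ | a, v⟩ <;> rfl

theorem wp_bind (m : Proto p N α) (f : α → Proto p N β) (view : List (Event p N)) (F) :
    wp (m >>= f) view F = wp m view (wpBind f F) := by
  rw [wp, exec_bind, expect_bind]
  refine congrArg (expect _) (funext fun z => ?_)
  rcases z with ⟨_ | a, v⟩
  · simp [expect_pure, wpBind]
  · simp [wpBind, wp]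

theorem exec_pure (a : α) (view : List (Event p N)) :
    (pure a : Proto p N α).exec view = PMF.pure (some a, view) := rfl

theorem wp_pure (a : α) (view : List (Event p N)) (F) :
    wp (pure a : Proto p N α) view F = F (some a) view := by
  rw [wp, exec_pure, expect_pure]

theorem wp_failure (view : List (Event p N)) (F) :
    wp (failure : Proto p N α) view F = F none view := by
  have : (failure : Proto p N α).exec view = PMF.pure (none, view) := rfl
  rw [wp, this, expect_pure]

theorem wp_mono (m : Proto p N α) (view : List (Event p N)) {F G}
    (h : ∀ o v, F o v ≤ G o v) : wp m view F ≤ wp m view G :=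
  expect_mono _ fun _ => h _ _

theorem wp_liftM (μ : PMF α) (view : List (Event p N)) (F) :
    wp (liftM μ : Proto p N α) view F = expect μ fun a => F (some a) view := by
  have : (liftM μ : Proto p N α).exec view = μ.map fun a => (some a, view) := by
    rw [← PMF.bind_pure_comp]
    change (μ.bind fun a => PMF.pure (a, view)).bind _ = _
    rw [PMF.bind_bind]
    refine congrArg (PMF.bind μ) (funext fun z => ?_)
    rw [PMF.pure_bind]
    rfl
  rw [wp, this, expect_map]

theorem wp_modify (g : List (Event p N) → List (Event p N)) (view : List (Event p N)) (F) :
    wp (modify g : Proto p N PUnit) view F = F (some ⟨⟩) (g view) := by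
  have : (modify g : Proto p N PUnit).exec view = PMF.pure (some ⟨⟩, g view) := by
    change (PMF.pure (PUnit.unit, g view)).bind _ = _
    rw [PMF.pure_bind]
    rfl
  rw [wp, this, expect_pure]

theorem wp_get (view : List (Event p N)) (F) :
    wp (get : Proto p N _) view F = F (some view) view := by
  have : (get : Proto p N _).exec view = PMF.pure (some view, view) := by
    change (PMF.pure (view, view)).bind _ = _
    rw [PMF.pure_bind]
    rfl
  rw [wp, this, expect_pure]

theorem exec_apply (m : Proto p N α) (view : List (Event p N)) (o : Option α)
    (v : List (Event p N)) [DecidableEq (Option α)] [DecidableEq (List (Event p N))] :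
    m.exec view (o, v) = wp m view fun o' v' => if o' = o ∧ v' = v then 1 else 0 := by
  classical
  rw [wp, ← expect_single]
  refine congrArg (expect _) (funext fun z => ?_)
  simp only [Prod.ext_iff]

/-! ### Couplings of two runs, and correctness with a failure bound. -/

/-- `m₁` and `m₂` can be coupled such that the views agree, either both or none of the runs fail,
and the outcomes are related by `R`. The coupling is expressed through its action on
post-expectations. -/
def Rel (R : α → β → Prop) (m₁ : Proto p N α) (m₂ : Proto p N β) : Prop :=
  ∀ view F G, (∀ v, F none v ≤ G none v) → (∀ a b v, R a b → F (some a) v ≤ G (some b) v) →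
    wp m₁ view F ≤ wp m₂ view G

theorem Rel.pure {R : α → β → Prop} {a : α} {b : β} (h : R a b) :
    Rel (p := p) (N := N) R (pure a) (pure b) := by
  intro view F G _ h1
  rw [wp_pure, wp_pure]
  exact h1 _ _ _ h

theorem Rel.refl (m : Proto p N α) : Rel Eq m m := by
  intro view F G h0 h1
  refine wp_mono _ _ fun o v => ?_
  rcases o with _ | a
  · exact h0 v
  · exact h1 a a v rfl

theorem Rel.mono {R S : α → β → Prop} {m₁ : Proto p N α} {m₂ : Proto p N β} (h : Rel R m₁ m₂)
    (hRS : ∀ a b, R a b → S a b) : Rel S m₁ m₂ :=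
  fun view F G h0 h1 => h view F G h0 fun a b v hab => h1 a b v (hRS a b hab)

theorem Rel.bind {R : α → β → Prop} {S : γ → δ → Prop} {m₁ : Proto p N α} {m₂ : Proto p N β}
    {f₁ : α → Proto p N γ} {f₂ : β → Proto p N δ} (h : Rel R m₁ m₂)
    (hf : ∀ a b, R a b → Rel S (f₁ a) (f₂ b)) : Rel S (m₁ >>= f₁) (m₂ >>= f₂) := by
  intro view F G h0 h1
  rw [wp_bind, wp_bind]
  exact h view _ _ h0 fun a b v hab => hf a b hab v F G h0 h1

open Classical in
/-- The post-expectation that counts failing runs and forbids outcomes outside `P`. -/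
def badness (P : α → Prop) : Option α → ENNReal
  | none => 1
  | some a => if P a then 0 else ⊤

/-- Every outcome of `m` satisfies `P`, and `m` fails with probability at most `c`. -/
def Ensures (P : α → Prop) (c : ENNReal) (m : Proto p N α) : Prop :=
  ∀ view, wp m view (fun o _ => badness P o) ≤ c

theorem Ensures.pure {P : α → Prop} {a : α} (h : P a) : Ensures (p := p) (N := N) P 0 (pure a) := by
  intro view
  rw [wp_pure]
  simp [badness, h]

theorem Ensures.mono {P Q : α → Prop} {c c' : ENNReal} {m : Proto p N α} (h : Ensures P c m)
    (hPQ : ∀ a, P a → Q a) (hc : c ≤ c') : Ensures Q c' m := by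
  intro view
  refine le_trans (wp_mono _ _ fun o v => ?_) ((h view).trans hc)
  rcases o with _ | a
  · exact le_rfl
  · by_cases ha : P a
    · simp [badness, hPQ a ha]
    · simp [badness, ha]

theorem Ensures.weaken {P Q : α → Prop} {c : ENNReal} {m : Proto p N α} (h : Ensures P c m)
    (hPQ : ∀ a, P a → Q a) : Ensures Q c m := h.mono hPQ le_rfl

theorem Ensures.bind {P : α → Prop} {Q : β → Prop} {c c' : ENNReal} {m : Proto p N α}
    {f : α → Proto p N β} (h : Ensures P c m) (hf : ∀ a, P a → Ensures Q c' (f a)) :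
    Ensures Q (c + c') (m >>= f) := by
  intro view
  rw [wp_bind]
  calc wp m view (wpBind f fun o _ => badness Q o)
      ≤ wp m view (fun o _ => badness P o + c') := wp_mono _ _ fun o v => by
        rcases o with _ | a
        · exact le_self_add
        · by_cases ha : P a
          · simpa [badness, ha, wpBind] using hf a ha v
          · simp [badness, ha]
    _ = wp m view (fun o _ => badness P o) + c' := by
        simp only [wp]; rw [expect_add, expect_const]
    _ ≤ c + c' := by gcongr; exact h view

theorem Ensures.bind_zero {P : α → Prop} {Q : β → Prop} {c : ENNReal} {m : Proto p N α}
    {f : α → Proto p N β} (h : Ensures P 0 m) (hf : ∀ a, P a → Ensures Q c (f a)) :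
    Ensures Q c (m >>= f) := by simpa using h.bind hf

theorem Ensures.bind_zero_right {P : α → Prop} {Q : β → Prop} {c : ENNReal} {m : Proto p N α}
    {f : α → Proto p N β} (h : Ensures P c m) (hf : ∀ a, P a → Ensures Q 0 (f a)) :
    Ensures Q c (m >>= f) := by simpa using h.bind hf

/-- An outcome outside `P` has weight `⊤`, so positive probability would make the expected cost
infinite. -/
theorem Ensures.exec_eq_zero {P : α → Prop} {c : ENNReal} {m : Proto p N α} (h : Ensures P c m)
    (hc : c ≠ ⊤) {a : α} (ha : ¬ P a) (view v : List (Event p N)) :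
    m.exec view (some a, v) = 0 := by
  by_contra hne
  have h1 : m.exec view (some a, v) * badness P (some a) ≤ c :=
    (ENNReal.le_tsum (f := fun z => m.exec view z * badness P z.1) (some a, v)).trans (h view)
  simp [badness, ha, ENNReal.mul_top hne, hc] at h1

theorem Ensures.of_mem_support {P : α → Prop} {c : ENNReal} {m : Proto p N α} (h : Ensures P c m)
    (hc : c ≠ ⊤) {a : α} {view v : List (Event p N)} (ha : (some a, v) ∈ (m.exec view).support) :
    P a := by
  by_contra hP
  exact (PMF.mem_support_iff _ _).1 ha (h.exec_eq_zero hc hP view v)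

theorem Ensures.wp_le {P : α → Prop} {c : ENNReal} {m : Proto p N α} (h : Ensures P c m)
    (hc : c ≠ ⊤) {F G : Option α → List (Event p N) → ENNReal} (h0 : ∀ v, F none v ≤ G none v)
    (h1 : ∀ a v, P a → F (some a) v ≤ G (some a) v) (view : List (Event p N)) :
    wp m view F ≤ wp m view G := by
  refine ENNReal.tsum_le_tsum fun z => ?_
  rcases z with ⟨_ | a, v⟩
  · exact mul_le_mul_right (h0 v) _
  · by_cases ha : P a
    · exact mul_le_mul_right (h1 a v ha) _
    · simp [h.exec_eq_zero hc ha]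

/-- On null sets the post-expectations may be altered freely: lowering `F` to `0` outside `P` and
raising `G` to `⊤` outside `Q` changes neither expectation and makes the required inequality trivial
there. Thus correctness facts can be added to a coupling afterwards. -/
theorem Rel.and_ensures {R : α → β → Prop} {P : α → Prop} {Q : β → Prop} {c c' : ENNReal}
    {m₁ : Proto p N α} {m₂ : Proto p N β} (h : Rel R m₁ m₂) (h1 : Ensures P c m₁) (hc : c ≠ ⊤)
    (h2 : Ensures Q c' m₂) (hc' : c' ≠ ⊤) : Rel (fun a b => R a b ∧ P a ∧ Q b) m₁ m₂ := by
  classical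
  intro view F G g0 g1
  let F' : Option α → List (Event p N) → ENNReal := fun o v =>
    match o with
    | none => F none v
    | some a => if P a then F (some a) v else 0
  let G' : Option β → List (Event p N) → ENNReal := fun o v =>
    match o with
    | none => G none v
    | some a => if Q a then G (some a) v else ⊤
  calc wp m₁ view F ≤ wp m₁ view F' :=
        h1.wp_le (F := F) (G := F') hc (fun v => le_rfl) (fun a v ha => by simp [F', ha]) view
    _ ≤ wp m₂ view G' := h view F' G' g0 fun a b v hab => by
        by_cases hP : P a
        · by_cases hQ : Q b
          · simpa [F', G', hP, hQ] using g1 a b v ⟨hab, hP, hQ⟩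
          · simp [G', hQ]
        · simp [F', hP]
    _ ≤ wp m₂ view G :=
        h2.wp_le (F := G') (G := G) hc' (fun v => le_rfl) (fun a v ha => by simp [G', ha]) view

theorem Rel.exec_le {R : α → β → Prop} {m₁ : Proto p N α} {m₂ : Proto p N β} (h : Rel R m₁ m₂)
    {a : α} {b : β} (hab : ∀ x y, R x y → x = a → y = b) (view v : List (Event p N)) :
    m₁.exec view (some a, v) ≤ m₂.exec view (some b, v) := by
  classical
  rw [exec_apply, exec_apply]
  refine h _ _ _ (fun v => by simp) fun x y v' hxy => ?_
  by_cases hx : x = a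
  · simp [hx, hab x y hxy hx]
  · simp [hx]

theorem Rel.exec_eq_zero {R : α → β → Prop} {m₁ : Proto p N α} {m₂ : Proto p N β} (h : Rel R m₁ m₂)
    {a : α} (ha : ∀ x y, R x y → x ≠ a) (view v : List (Event p N)) :
    m₁.exec view (some a, v) = 0 := by
  classical
  rw [exec_apply]
  refine le_antisymm ((h _ _ (fun _ _ => 0) (fun v => by simp) fun x y v' hxy => ?_).trans ?_) bot_le
  · simp [ha x y hxy]
  · simp [wp, expect]

/-- Transport along an injection that does not decrease probabilities. -/
theorem wp_le_of_injOn (m : Proto p N α) (view : List (Event p N))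
    {F G : Option α → List (Event p N) → ENNReal} (S : Set α) (τ : α → α) (hτ : Set.InjOn τ S)
    (hm : ∀ a ∈ S, ∀ v, m.exec view (some a, v) ≤ m.exec view (some (τ a), v))
    (h0 : ∀ v, F none v ≤ G none v) (h1 : ∀ a ∈ S, ∀ v, F (some a) v ≤ G (some (τ a)) v)
    (hS : ∀ a, a ∉ S → ∀ v, m.exec view (some a, v) * F (some a) v = 0) :
    wp m view F ≤ wp m view G := by
  -- The failed runs belong to `Z` as well and are left fixed by `T`.
  let Z : Set (Option α × List (Event p N)) := {z | ∀ a, z.1 = some a → a ∈ S}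
  let T : Z → Option α × List (Event p N) := fun z => (z.1.1.map τ, z.1.2)
  have hT : Function.Injective T := by
    rintro ⟨⟨o, v⟩, ho⟩ ⟨⟨o', v'⟩, ho'⟩ h
    simp only [T, Prod.mk.injEq] at h
    obtain ⟨h1, rfl⟩ := h
    rcases o with _ | a <;> rcases o' with _ | a' <;> simp at h1 ⊢
    exact hτ (ho a rfl) (ho' a' rfl) h1
  calc wp m view F = ∑' z : Z, m.exec view z * F z.1.1 z.1.2 := by
        rw [wp, expect]
        refine (tsum_subtype_eq_of_support_subset
          (f := fun z => m.exec view z * F z.1 z.2) fun z hz => ?_).symm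
        rcases z with ⟨o, v⟩
        rintro a rfl
        by_contra ha
        exact hz (hS a ha v)
    _ ≤ ∑' z : Z, m.exec view (T z) * G (T z).1 (T z).2 := by
        refine ENNReal.tsum_le_tsum fun z => ?_
        rcases z with ⟨⟨_ | a, v⟩, hz⟩
        · exact mul_le_mul_right (h0 v) _
        · exact mul_le_mul' (hm a (hz a rfl) v) (h1 a (hz a rfl) v)
    _ ≤ wp m view G :=
        ENNReal.tsum_comp_le_tsum_of_injective hT fun z => m.exec view z * G z.1 z.2

/-! ### Repeated attempts. -/

theorem wp_retry_succ (K : ℕ) (m : Proto p N (Option α)) (view : List (Event p N)) (F) :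
    wp (retry (K + 1) m) view F = wp m view fun o v =>
      match o with
      | none => F none v
      | some none => wp (retry K m) v F
      | some (some a) => F (some a) v := by
  rw [retry, wp_bind]
  congr 1
  funext o v
  rcases o with _ | _ | a
  · rfl
  · rfl
  · exact wp_pure _ _ _

theorem le_half_of_le_of_add_le {x y : ENNReal} (h : x ≤ y) (h1 : x + y ≤ 1) : x ≤ 2⁻¹ := by
  rw [ENNReal.le_inv_iff_mul_le, mul_two]
  exact (add_le_add_right h x).trans h1

open Classical in
/-- Failure of a repeated attempt. -/
theorem Ensures.retry {P : α → Prop} {c : ENNReal} {m : Proto p N (Option α)}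
    (h : Ensures (fun o => ∀ a, o = some a → P a) c m)
    (hnone : ∀ view, wp m view (fun o _ => if o = some none then 1 else 0) ≤ 2⁻¹) (K : ℕ) :
    Ensures P (2⁻¹ ^ K + 2 * c) (retry K m) := by
  induction K with
  | zero =>
    intro view
    rw [ObliviousGate.retry, wp_failure]
    simp [badness]
  | succ K ih =>
    intro view
    rw [wp_retry_succ]
    -- The failure bound obeys the recursion `x ↦ c + x / 2`, whose fixed point is `2 * c`; the
    -- deviation from it starts at `1` and halves with every attempt.
    calc _ ≤ wp m view (fun o _ => badness (fun o => ∀ a, o = some a → P a) o +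
          (2⁻¹ ^ K + 2 * c) * (if o = some none then 1 else 0)) := wp_mono _ _ fun o v => by
          rcases o with _ | _ | a
          · simp [badness]
          · simpa [badness] using ih v
          · by_cases ha : P a <;> simp [badness, ha]
      _ ≤ c + (2⁻¹ ^ K + 2 * c) * 2⁻¹ := by
          simp only [wp]
          rw [expect_add, expect_mul]
          exact add_le_add (h view) (mul_le_mul_right (hnone view) _)
      _ = 2⁻¹ ^ (K + 1) + 2 * c := by
          rw [add_mul, ← pow_succ, mul_right_comm, ENNReal.mul_inv_cancel (by simp) (by simp)]
          ring

/-- Probabilities of the outcomes of a repeated attempt compare like those of a single one. -/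
theorem exec_retry_le {m : Proto p N (Option α)} {a a' : α}
    (h : ∀ view v, m.exec view (some (some a), v) ≤ m.exec view (some (some a'), v)) (K : ℕ)
    (view v : List (Event p N)) :
    (retry K m).exec view (some a, v) ≤ (retry K m).exec view (some a', v) := by
  classical
  induction K generalizing view with
  | zero =>
    rw [exec_apply, exec_apply, retry, wp_failure, wp_failure]
    simp
  | succ K ih =>
    rw [exec_apply, exec_apply, wp_retry_succ, wp_retry_succ]
    -- Only a rejected first attempt or one that yields `a` can lead to the final outcome `a`.
    refine wp_le_of_injOn m view {none, some a} (fun o => o.map fun _ => a') ?_ ?_ ?_ ?_ ?_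
    · rintro _ (rfl | rfl) _ (rfl | rfl) <;> simp
    · rintro _ (rfl | rfl) v'
      · exact le_rfl
      · exact h view v'
    · intro v'; simp
    · rintro _ (rfl | rfl) v'
      · have := ih v'
        rwa [exec_apply, exec_apply] at this
      · simp
    · intro o ho v'
      rcases o with _ | b
      · simp at ho
      · have : b ≠ a := by simpa using ho
        simp [this]

end Calculus

/-! ### Vectors of shares of polynomials -/

section PolyShares

variable {p N : ℕ} [Fact p.Prime]

/-- `v` consists of the values of a polynomial of degree at most `k` with value `a` at `0`. -/
def PolyShares (k : ℕ) (v : Shares p N) (a : ZMod p) : Prop :=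
  ∃ f : Polynomial (ZMod p), f.natDegree ≤ k ∧ f.eval 0 = a ∧ ∀ i, v i = f.eval (point p i)

variable {k l : ℕ} {v w : Shares p N} {a b : ZMod p}

theorem PolyShares.add (hv : PolyShares k v a) (hw : PolyShares k w b) :
    PolyShares k (v + w) (a + b) := by
  obtain ⟨f, hf, rfl, hf'⟩ := hv
  obtain ⟨g, hg, rfl, hg'⟩ := hw
  exact ⟨f + g, (Polynomial.natDegree_add_le _ _).trans (max_le hf hg), by simp,
    fun i => by simp [hf', hg']⟩

theorem PolyShares.sub (hv : PolyShares k v a) (hw : PolyShares k w b) :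
    PolyShares k (v - w) (a - b) := by
  obtain ⟨f, hf, rfl, hf'⟩ := hv
  obtain ⟨g, hg, rfl, hg'⟩ := hw
  exact ⟨f - g, (Polynomial.natDegree_sub_le _ _).trans (max_le hf hg), by simp,
    fun i => by simp [hf', hg']⟩

theorem PolyShares.smul (c : ZMod p) (hv : PolyShares k v a) : PolyShares k (c • v) (c * a) := by
  obtain ⟨f, hf, rfl, hf'⟩ := hv
  exact ⟨c • f, (Polynomial.natDegree_smul_le _ _).trans hf, by simp, fun i => by simp [hf']⟩

theorem PolyShares.mul (hv : PolyShares k v a) (hw : PolyShares l w b) :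
    PolyShares (k + l) (v * w) (a * b) := by
  obtain ⟨f, hf, rfl, hf'⟩ := hv
  obtain ⟨g, hg, rfl, hg'⟩ := hw
  exact ⟨f * g, Polynomial.natDegree_mul_le.trans (add_le_add hf hg), by simp,
    fun i => by simp [hf', hg']⟩

theorem polyShares_const (k : ℕ) (a : ZMod p) : PolyShares (N := N) k (const a) a :=
  ⟨Polynomial.C a, by simp, by simp, fun i => by simp [const]⟩

theorem polyShares_zero (k : ℕ) : PolyShares (p := p) (N := N) k 0 0 :=
  ⟨0, by simp, by simp, fun i => by simp⟩

theorem PolyShares.mono (h : PolyShares k v a) (hkl : k ≤ l) : PolyShares l v a := by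
  obtain ⟨f, hf, h⟩ := h
  exact ⟨f, hf.trans hkl, h⟩

theorem PolyShares.congr (h : PolyShares k v a) (hab : a = b) : PolyShares k v b := hab ▸ h

theorem PolyShares.sum {ι : Type*} (s : Finset ι) {v : ι → Shares p N} {a : ι → ZMod p}
    (h : ∀ i ∈ s, PolyShares k (v i) (a i)) : PolyShares k (∑ i ∈ s, v i) (∑ i ∈ s, a i) := by
  classical
  induction s using Finset.induction_on with
  | empty => simpa using polyShares_zero k
  | insert i s hi ih =>
    rw [Finset.sum_insert hi, Finset.sum_insert hi]
    exact (h i (by simp)).add (ih fun j hj => h j (by simp [hj]))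

theorem point_injective (hNp : N < p) : Function.Injective (point p : Fin N → ZMod p) := by
  intro i j h
  simp only [point] at h
  rw [ZMod.natCast_eq_natCast_iff', Nat.mod_eq_of_lt (by omega), Nat.mod_eq_of_lt (by omega)] at h
  exact Fin.ext (by omega)

theorem point_ne_zero (hNp : N < p) (i : Fin N) : point p i ≠ 0 := by
  rw [point, Ne, ZMod.natCast_eq_zero_iff]
  exact Nat.not_dvd_of_pos_of_lt (by omega) (by omega)

/-- Two polynomials of degree at most `k` that agree at more than `k` of the points agree. -/
theorem eq_of_agree (hNp : N < p) {f g : Polynomial (ZMod p)} (hf : f.natDegree ≤ k)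
    (hg : g.natDegree ≤ k) (s : Finset (Fin N)) (hs : k < s.card)
    (h : ∀ i ∈ s, f.eval (point p i) = g.eval (point p i)) : f = g := by
  rw [← sub_eq_zero]
  refine Polynomial.eq_zero_of_natDegree_lt_card_of_eval_eq_zero' _
    (s.image (point p)) ?_ ?_
  · intro x hx
    obtain ⟨i, hi, rfl⟩ := Finset.mem_image.1 hx
    simp [h i hi]
  · rw [Finset.card_image_of_injective _ (point_injective hNp)]
    exact ((Polynomial.natDegree_sub_le _ _).trans (max_le hf hg)).trans_lt hs

theorem PolyShares.unique (hNp : N < p) (hk : k < N) (h : PolyShares k v a)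
    (h' : PolyShares k v b) : a = b := by
  obtain ⟨f, hf, rfl, hf'⟩ := h
  obtain ⟨g, hg, rfl, hg'⟩ := h'
  rw [eq_of_agree hNp hf hg Finset.univ (by simpa using hk) fun i _ => by rw [← hf', ← hg']]

/-- The true polynomial and the decoded one each miss the word in at most `(N - deg N - 1) / 2`
places. They therefore agree at no fewer than `deg N + 1` points and coincide, whichever witness
`decode` has chosen. -/
theorem decode_eq (hNp : N < p) (hN : 0 < N) {w : Fin N → ZMod p} (hv : IsSharing v a)
    (hw : (Finset.univ.filter fun i => v i ≠ w i).card ≤ (N - deg N - 1) / 2) :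
    decode w = a := by
  classical
  obtain ⟨f, hf, rfl, hf'⟩ := hv
  have h : ∃ f : Polynomial (ZMod p), f.natDegree ≤ deg N ∧
      (Finset.univ.filter fun i => f.eval (point p i) ≠ w i).card ≤ (N - deg N - 1) / 2 :=
    ⟨f, hf, by simpa only [hf'] using hw⟩
  have hd : decode w = h.choose.eval 0 := by
    unfold decode
    convert dif_pos h
  rw [hd]
  have h1 := h.choose_spec.1
  have h2 := h.choose_spec.2
  set g := h.choose
  simp only [hf'] at hw
  congr 1
  set s := (Finset.univ.filter fun i => g.eval (point p i) ≠ w i) ∪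
    (Finset.univ.filter fun i => f.eval (point p i) ≠ w i) with hs
  have hs' : s.card ≤ (N - deg N - 1) / 2 + (N - deg N - 1) / 2 :=
    (Finset.card_union_le _ _).trans (add_le_add h2 hw)
  have hc : sᶜ.card = N - s.card := by rw [Finset.card_compl, Fintype.card_fin]
  have hdN : deg N < N := Nat.div_lt_self hN (by norm_num)
  refine eq_of_agree hNp h1 hf sᶜ (by omega) fun i hi => ?_
  simp only [hs, Finset.mem_compl, Finset.mem_union, Finset.mem_filter, Finset.mem_univ, true_and,
    not_or, not_not] at hi
  rw [hi.1, hi.2]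

theorem sharesOf_add (k : ℕ) (c c' : ℕ → ZMod p) :
    sharesOf (N := N) k (c + c') = sharesOf k c + sharesOf k c' := by
  funext i
  simp [sharesOf, add_mul, Finset.sum_add_distrib]

theorem polyShares_sharesOf (k : ℕ) (c : ℕ → ZMod p) :
    PolyShares (N := N) k (sharesOf k c) (c 0) := by
  refine ⟨∑ m ∈ Finset.range (k + 1), Polynomial.C (c m) * Polynomial.X ^ m, ?_, ?_, ?_⟩
  · refine Polynomial.natDegree_sum_le_of_forall_le _ _ fun m hm => ?_
    exact (Polynomial.natDegree_C_mul_X_pow_le _ _).trans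
      (Nat.lt_succ_iff.1 (Finset.mem_range.1 hm))
  · rw [Polynomial.eval_finsetSum, Finset.sum_eq_single 0] <;> simp +contextual
  · intro i
    simp [sharesOf, Polynomial.eval_finsetSum]

theorem sharesOf_congr {c c' : ℕ → ZMod p} (h : ∀ m ≤ k, c m = c' m) :
    sharesOf (N := N) k c = sharesOf k c' := by
  funext i
  exact Finset.sum_congr rfl fun m hm => by rw [h m (Nat.lt_succ_iff.1 (Finset.mem_range.1 hm))]

theorem PolyShares.exists_coeff (h : PolyShares k v a) :
    ∃ c : ℕ → ZMod p, c 0 = a ∧ v = sharesOf k c := by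
  obtain ⟨f, hf, rfl, hf'⟩ := h
  refine ⟨f.coeff, Polynomial.coeff_zero_eq_eval_zero f, funext fun i => ?_⟩
  rw [hf', Polynomial.eval_eq_sum_range' (Nat.lt_succ_of_le hf), sharesOf]

end PolyShares

/-! ### Sharings that are invisible to the adversary -/

section Hidden

variable {p N : ℕ} [Fact p.Prime] (A : Adversary p N)

/-- The two vectors coincide on the dishonest parties. -/
def SameHeld (v w : Shares p N) : Prop := ∀ i ∈ A.corrupt, v i = w i

variable {A} {k : ℕ} {v w v' w' : Shares p N} {a b : ZMod p}

theorem sameHeld_iff : SameHeld A v w ↔ A.seeHeld v = A.seeHeld w := by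
  constructor
  · intro h
    funext i
    by_cases hi : i ∈ A.corrupt <;> simp [Adversary.seeHeld, hi, h i]
  · intro h i hi
    simpa [Adversary.seeHeld, hi] using congrFun h i

theorem SameHeld.refl (v : Shares p N) : SameHeld A v v := fun _ _ => rfl

theorem SameHeld.symm (h : SameHeld A v w) : SameHeld A w v := fun i hi => (h i hi).symm

theorem SameHeld.add (h : SameHeld A v w) (h' : SameHeld A v' w') :
    SameHeld A (v + v') (w + w') := fun i hi => by simp [h i hi, h' i hi]

theorem SameHeld.sub (h : SameHeld A v w) (h' : SameHeld A v' w') :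
    SameHeld A (v - v') (w - w') := fun i hi => by simp [h i hi, h' i hi]

theorem SameHeld.smul (c : ZMod p) (h : SameHeld A v w) :
    SameHeld A (c • v) (c • w) := fun i hi => by simp [h i hi]

/-- A sharing of `a` on a polynomial of degree at most `k` in which all dishonest shares vanish. -/
def Hidden (A : Adversary p N) (k : ℕ) (Δ : Shares p N) (a : ZMod p) : Prop :=
  PolyShares k Δ a ∧ ∀ i ∈ A.corrupt, Δ i = 0

theorem Hidden.add (h : Hidden A k v a) (h' : Hidden A k w b) : Hidden A k (v + w) (a + b) :=
  ⟨h.1.add h'.1, fun i hi => by simp [h.2 i hi, h'.2 i hi]⟩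

theorem Hidden.sub (h : Hidden A k v a) (h' : Hidden A k w b) : Hidden A k (v - w) (a - b) :=
  ⟨h.1.sub h'.1, fun i hi => by simp [h.2 i hi, h'.2 i hi]⟩

theorem Hidden.smul (c : ZMod p) (h : Hidden A k v a) : Hidden A k (c • v) (c * a) :=
  ⟨h.1.smul c, fun i hi => by simp [h.2 i hi]⟩

theorem Hidden.congr (h : Hidden A k v a) (hab : a = b) : Hidden A k v b := hab ▸ h

theorem hidden_zero : Hidden A k 0 0 := ⟨polyShares_zero k, fun _ _ => rfl⟩

theorem hidden_sub (hv : PolyShares k v a) (hw : PolyShares k w b) (h : SameHeld A v w) :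
    Hidden A k (v - w) (a - b) := ⟨hv.sub hw, fun i hi => by simp [h i hi]⟩

theorem Hidden.sameHeld_add (h : Hidden A k w a) (v : Shares p N) : SameHeld A v (v + w) :=
  fun i hi => by simp [h.2 i hi]

/-- The dishonest shares do not determine the secret. -/
theorem exists_hidden (hNp : N < p) (A : Adversary p N) (hA : A.corrupt.card ≤ k) (a : ZMod p) :
    ∃ Δ, Hidden A k Δ a := by
  classical
  -- Each factor is `1` at `0` and vanishes at one dishonest point, which is invertible because `N <
  -- p`.
  refine ⟨fun i => a * ∏ j ∈ A.corrupt, (1 - (point p j)⁻¹ * point p i),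
    ⟨Polynomial.C a * ∏ j ∈ A.corrupt, (1 - Polynomial.C (point p j)⁻¹ * Polynomial.X),
      ?_, ?_, ?_⟩, ?_⟩
  · refine (Polynomial.natDegree_C_mul_le _ _).trans
      ((Polynomial.natDegree_prod_le _ _).trans (le_trans ?_ hA))
    rw [Finset.card_eq_sum_ones]
    refine Finset.sum_le_sum fun j _ => ?_
    refine (Polynomial.natDegree_sub_le _ _).trans (max_le (by simp) ?_)
    exact (Polynomial.natDegree_C_mul_le _ _).trans (by simp)
  · simp [Polynomial.eval_prod]
  · intro i
    simp [Polynomial.eval_prod]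
  · intro i hi
    refine mul_eq_zero_of_right _ (Finset.prod_eq_zero hi ?_)
    rw [inv_mul_cancel₀ (point_ne_zero hNp i), sub_self]

end Hidden

/-! ### The primitives -/

section Primitives

variable {p N : ℕ} [Fact p.Prime] {A : Adversary p N}

theorem exists_honest (hN : 0 < N) (hA : 6 * A.corrupt.card ≤ N) : ∃ j, j ∉ A.corrupt := by
  by_contra! h
  have : A.corrupt = Finset.univ := Finset.eq_univ_iff_forall.2 h
  simp [this] at hA
  omega

/-- The view after the honest dealings with coefficients `c`. -/
def dealView (A : Adversary p N) (zero : Bool) (k : ℕ) (view : List (Event p N))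
    (c : Fin N → Fin (k + 1) → ZMod p) : List (Event p N) :=
  view ++ [Event.received (A.seeSent fun j i => sharesOf k (dealtCoeff zero k (c j)) i)]

/-- The sum of all dealings when the honest coefficients are `c` and the view is `view`. -/
def dealtSum (A : Adversary p N) (zero : Bool) (k : ℕ) (view : List (Event p N))
    (c : Fin N → Fin (k + 1) → ZMod p) : Shares p N :=
  fun i => ∑ j, sharesOf k (if j ∈ A.corrupt then dealtCoeff zero k (fun m => A.deal view j m)
    else dealtCoeff zero k (c j)) i

theorem wp_dealAndAdd (zero : Bool) (k : ℕ) (view : List (Event p N)) (F) :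
    wp (dealAndAdd A zero k) view F = expect (PMF.uniformOfFintype _) fun c =>
      F (some (dealtSum A zero k (dealView A zero k view c) c)) (dealView A zero k view c) := by
  unfold dealAndAdd
  rw [wp_bind, wp_liftM]
  simp only [wpBind, wp_bind, wp_modify, wp_get, wp_pure]
  rfl

theorem dealtCoeff_zero (k : ℕ) (c : Fin (k + 1) → ZMod p) : dealtCoeff true k c 0 = 0 := by
  simp [dealtCoeff]

theorem ensures_dealAndAdd (zero : Bool) (k : ℕ) :
    Ensures (fun v => ∃ a, PolyShares k v a ∧ (zero = true → a = 0)) 0 (dealAndAdd A zero k) := by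
  intro view
  rw [wp_dealAndAdd]
  refine (expect_mono _ fun c => ?_).trans (expect_const _ 0).le
  rw [badness, if_pos]
  have : dealtSum A zero k (dealView A zero k view c) c = ∑ j, sharesOf k
      (if j ∈ A.corrupt then dealtCoeff zero k (fun m => A.deal (dealView A zero k view c) j m)
        else dealtCoeff zero k (c j)) := by
    funext i
    rw [Finset.sum_apply]
    rfl
  rw [this]
  refine ⟨_, PolyShares.sum _ fun j _ => polyShares_sharesOf k _, ?_⟩
  rintro rfl
  refine Finset.sum_eq_zero fun j _ => ?_
  split_ifs <;> exact dealtCoeff_zero _ _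

theorem sharesOf_dealtCoeff_add {zero : Bool} {k : ℕ} (c : Fin (k + 1) → ZMod p) {f : ℕ → ZMod p}
    (hf : zero = true → f 0 = 0) :
    sharesOf (N := N) k (dealtCoeff zero k (c + fun m : Fin (k + 1) => f m)) =
      sharesOf k (dealtCoeff zero k c) + sharesOf k f := by
  rw [← sharesOf_add]
  refine sharesOf_congr fun m hm => ?_
  rw [Pi.add_apply]
  unfold dealtCoeff
  split_ifs with h h'
  · rw [h.2, hf h.1, add_zero]
  · rfl
  · omega

/-- A round of dealings hides everything but the dishonest shares (and the secret, if that is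
prescribed). -/
theorem rel_dealAndAdd (hN : 0 < N) (hA : 6 * A.corrupt.card ≤ N) {zero : Bool} {k : ℕ}
    {Δ : Shares p N} {a : ZMod p} (hΔ : Hidden A k Δ a) (ha : zero = true → a = 0) :
    Rel (fun v w => w = v + Δ) (dealAndAdd A zero k) (dealAndAdd A zero k) := by
  classical
  intro view F G _ h1
  obtain ⟨j₀, hj₀⟩ := exists_honest hN hA
  obtain ⟨f, rfl, rfl⟩ := hΔ.1.exists_coeff
  -- The honest dealer `j₀` absorbs the whole shift; translation by `e` preserves the uniform law of
  -- the coefficients.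
  let e : Fin N → Fin (k + 1) → ZMod p := Pi.single j₀ fun m => f m
  have key : ∀ (c : Fin N → Fin (k + 1) → ZMod p) (j : Fin N),
      sharesOf (N := N) k (dealtCoeff zero k ((c + e) j)) =
        sharesOf k (dealtCoeff zero k (c j)) + if j = j₀ then sharesOf k f else 0 := by
    intro c j
    by_cases hj : j = j₀
    · subst hj
      simp [e, sharesOf_dealtCoeff_add _ ha]
    · simp [e, hj]
  -- The adversary sees only shares at dishonest points, where `Δ` vanishes. Hence the dishonest
  -- dealers, who act on this view, make the same choices in both runs.
  have hview : ∀ c, dealView A zero k view (c + e) = dealView A zero k view c := by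
    intro c
    unfold dealView
    congr 3
    funext j i
    unfold Adversary.seeSent
    split_ifs with h
    · beta_reduce
      rw [key]
      by_cases hj : j = j₀
      · simp [hj, hΔ.2 i h.2]
      · simp [hj]
    · rfl
  have hsum : ∀ v c, dealtSum A zero k v (c + e) = dealtSum A zero k v c + sharesOf k f := by
    intro v c
    funext i
    have h2 : ∀ j, sharesOf k (if j ∈ A.corrupt then dealtCoeff zero k (fun m => A.deal v j m)
          else dealtCoeff zero k ((c + e) j)) i =
        sharesOf k (if j ∈ A.corrupt then dealtCoeff zero k (fun m => A.deal v j m)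
          else dealtCoeff zero k (c j)) i + if j = j₀ then sharesOf k f i else 0 := by
      intro j
      by_cases hj : j ∈ A.corrupt
      · have : j ≠ j₀ := fun h => hj₀ (h ▸ hj)
        simp [hj, this]
      · rw [if_neg hj, if_neg hj, key]
        by_cases hj' : j = j₀ <;> simp [hj']
    simp only [dealtSum, Pi.add_apply] at h2 ⊢
    simp [h2, Finset.sum_add_distrib]
  rw [wp_dealAndAdd, wp_dealAndAdd, ← expect_uniform_comp_equiv (Equiv.addRight e)
    fun c => G (some (dealtSum A zero k (dealView A zero k view c) c)) (dealView A zero k view c)]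
  refine expect_mono _ fun c => ?_
  simp only [Equiv.coe_addRight, hview, hsum]
  exact h1 _ _ _ rfl

/-- Errors occur only at the dishonest parties, whose number is within the decoding radius. Every
honest party thus decodes `a`, and the step is deterministic up to its effect on the view. -/
theorem wp_reconst (hNp : N < p) (hN : 0 < N) (hA : 6 * A.corrupt.card ≤ N) {v : Shares p N}
    {a : ZMod p} (hv : IsSharing v a) (view : List (Event p N)) (F) :
    wp (reconst A v) view F =
      F (some a) (view ++ [Event.received (A.seeSent fun i _ => v i)]) := by
  classical
  have hdec : ∀ s : Fin N → ZMod p,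
      decode (fun i => if i ∈ A.corrupt then s i else v i) = a := by
    intro s
    refine decode_eq hNp hN hv ((Finset.card_le_card (t := A.corrupt) ?_).trans ?_)
    · intro i hi
      by_contra h
      simp [h] at hi
    · simp only [deg]
      omega
  obtain ⟨j₀, hj₀⟩ := exists_honest hN hA
  unfold reconst
  simp only [wp_bind, wp_modify, wp_get, wpBind]
  have h : ∃ b : ZMod p, ∀ j, j ∉ A.corrupt → decode (fun i => if i ∈ A.corrupt then
      A.send (view ++ [Event.received (A.seeSent fun i _ => v i)]) i j else v i) = b :=
    ⟨a, fun j _ => hdec _⟩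
  have h' : h.choose = a := by rw [← h.choose_spec j₀ hj₀, hdec]
  convert wp_pure (p := p) (N := N) a _ F using 2
  convert dif_pos h
  exact h'.symm

theorem ensures_reconst (hNp : N < p) (hN : 0 < N) (hA : 6 * A.corrupt.card ≤ N) {v : Shares p N}
    {a : ZMod p} (hv : IsSharing v a) : Ensures (fun b => b = a) 0 (reconst A v) := by
  intro view
  rw [wp_reconst hNp hN hA hv]
  simp [badness]

/-- The same vector stands on both sides because the honest shares become part of the view; every
use must first make the two opened vectors equal. -/
theorem rel_reconst (hNp : N < p) (hN : 0 < N) (hA : 6 * A.corrupt.card ≤ N) {v : Shares p N}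
    {a : ZMod p} (hv : IsSharing v a) :
    Rel (fun b c => b = a ∧ c = a) (reconst A v) (reconst A v) :=
  ((Rel.refl _).and_ensures (ensures_reconst hNp hN hA hv) ENNReal.zero_ne_top
    (ensures_reconst hNp hN hA hv) ENNReal.zero_ne_top).mono fun _ _ h => h.2

theorem ensures_genRand (k : ℕ) : Ensures (fun v => ∃ a, PolyShares k v a) 0 (genRand A k) :=
  (ensures_dealAndAdd false k).weaken fun _ ⟨a, h, _⟩ => ⟨a, h⟩

theorem rel_genRand (hN : 0 < N) (hA : 6 * A.corrupt.card ≤ N) {k : ℕ}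
    {Δ : Shares p N} {a : ZMod p} (hΔ : Hidden A k Δ a) :
    Rel (fun v w => w = v + Δ ∧ (∃ b, PolyShares k v b) ∧ ∃ b, PolyShares k w b)
      (genRand A k) (genRand A k) :=
  (rel_dealAndAdd (zero := false) hN hA hΔ (by simp)).and_ensures (ensures_genRand k)
    ENNReal.zero_ne_top (ensures_genRand k) ENNReal.zero_ne_top

theorem ensures_renewShares {v : Shares p N} {a : ZMod p} (hv : IsSharing v a) :
    Ensures (fun w => IsSharing w a) 0 (renewShares A v) := by
  refine (ensures_dealAndAdd true (deg N)).bind_zero fun z hz => Ensures.pure ?_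
  obtain ⟨b, hz, hb⟩ := hz
  exact (PolyShares.add hv hz).congr (by rw [hb rfl, add_zero])

theorem rel_renewShares (hN : 0 < N) (hA : 6 * A.corrupt.card ≤ N) {v w Δ : Shares p N}
    {a b : ZMod p} (hv : IsSharing v a) (hw : IsSharing w b) (hvw : SameHeld A v w)
    (hΔ : Hidden A (deg N) Δ (b - a)) :
    Rel (fun x y => y = x + Δ ∧ IsSharing x a ∧ IsSharing y b)
      (renewShares A v) (renewShares A w) := by
  refine Rel.and_ensures ?_ (ensures_renewShares hv) ENNReal.zero_ne_top
    (ensures_renewShares hw) ENNReal.zero_ne_top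
  -- The dealt zero sharings must differ by the part of `Δ` that is not already present in the
  -- inputs; its secret is `0`, as verification prescribes.
  have h : Hidden A (deg N) (Δ - (w - v)) 0 :=
    (hΔ.sub (hidden_sub hw hv hvw.symm)).congr (sub_self _)
  refine (rel_dealAndAdd (zero := true) hN hA h fun _ => rfl).bind fun x y hxy => Rel.pure ?_
  rw [hxy]
  abel

/-- This is why the masks have degree `N / 6`: their product stays within degree `N / 3`. -/
theorem product_isSharing {u v : Shares p N} {a b : ZMod p} (hu : PolyShares (N / 6) u a)
    (hv : PolyShares (N / 6) v b) : IsSharing (u * v) (a * b) :=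
  (hu.mul hv).mono (by simp only [deg]; omega)

theorem isSharing_of_sixth {u : Shares p N} {a : ZMod p} (hu : PolyShares (N / 6) u a) :
    IsSharing u a := hu.mono (by simp only [deg]; omega)

theorem ensures_multiply (hNp : N < p) (hN : 0 < N) (hA : 6 * A.corrupt.card ≤ N)
    {v w : Shares p N} {a b : ZMod p} (hv : IsSharing v a) (hw : IsSharing w b) :
    Ensures (fun x => IsSharing x (a * b)) 0 (multiply A v w) := by
  refine (ensures_genRand _).bind_zero fun u₀ ⟨c, hu₀⟩ => ?_
  refine (ensures_genRand _).bind_zero fun v₀ ⟨d, hv₀⟩ => ?_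
  refine (ensures_renewShares (isSharing_of_sixth hu₀)).bind_zero fun u₁ hu₁ => ?_
  refine (ensures_renewShares (isSharing_of_sixth hv₀)).bind_zero fun v₁ hv₁ => ?_
  refine (ensures_renewShares (product_isSharing hu₀ hv₀)).bind_zero fun z hz => ?_
  refine (ensures_reconst hNp hN hA (PolyShares.add hv hu₁)).bind_zero fun ε hε => ?_
  refine (ensures_reconst hNp hN hA (PolyShares.add hw hv₁)).bind_zero fun δ hδ => Ensures.pure ?_
  refine PolyShares.congr ((((PolyShares.add hz (PolyShares.smul δ hv)).add
    (PolyShares.smul ε hw)).sub (polyShares_const _ _))) ?_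
  rw [hε, hδ]
  ring

/-- A product reveals nothing about its factors, and its honest shares are as random as the
dishonest ones and the secret permit. -/
theorem rel_multiply (hNp : N < p) (hN : 0 < N) (hA : 6 * A.corrupt.card ≤ N)
    {v w v' w' Δ : Shares p N} {a b a' b' : ZMod p} (hv : IsSharing v a) (hw : IsSharing w b)
    (hv' : IsSharing v' a') (hw' : IsSharing w' b') (hvv' : SameHeld A v v')
    (hww' : SameHeld A w w') (hΔ : Hidden A (deg N) Δ (a' * b' - a * b)) :
    Rel (fun x y => y = x + Δ ∧ IsSharing x (a * b) ∧ IsSharing y (a' * b'))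
      (multiply A v w) (multiply A v' w') := by
  refine Rel.and_ensures ?_ (ensures_multiply hNp hN hA hv hw) ENNReal.zero_ne_top
    (ensures_multiply hNp hN hA hv' hw') ENNReal.zero_ne_top
  have hA' : A.corrupt.card ≤ N / 6 := by omega
  have hdN : deg N < N := Nat.div_lt_self hN (by norm_num)
  -- The secrets of the masks are shifted so that the sums `a + u` and `b + v` agree in both runs.
  -- The shift must itself have degree at most `N / 6`, which is where the bound on the number of
  -- dishonest parties is sharp.
  obtain ⟨U, hU⟩ := exists_hidden hNp A hA' (a - a')
  obtain ⟨V, hV⟩ := exists_hidden hNp A hA' (b - b')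
  refine (rel_genRand hN hA hU).bind fun u₀ u₀' ⟨hu, ⟨c, hu₀⟩, ⟨c', hu₀'⟩⟩ => ?_
  refine (rel_genRand hN hA hV).bind fun v₀ v₀' ⟨hve, ⟨d, hv₀⟩, ⟨d', hv₀'⟩⟩ => ?_
  have hc : c' = c + (a - a') :=
    PolyShares.unique hNp hdN (isSharing_of_sixth hu₀') (isSharing_of_sixth (hu ▸ hu₀.add hU.1))
  have hd : d' = d + (b - b') :=
    PolyShares.unique hNp hdN (isSharing_of_sixth hv₀') (isSharing_of_sixth (hve ▸ hv₀.add hV.1))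
  have su : SameHeld A u₀ u₀' := hu ▸ hU.sameHeld_add u₀
  have sv : SameHeld A v₀ v₀' := hve ▸ hV.sameHeld_add v₀
  -- Equal secrets are not enough: renewal shifts the mask by exactly `v - v'`, so that the opened
  -- vectors themselves coincide.
  refine (rel_renewShares hN hA (isSharing_of_sixth hu₀) (isSharing_of_sixth hu₀') su
    ((hidden_sub hv hv' hvv').congr (b := c' - c) (by rw [hc]; ring))).bind
    fun u₁ u₁' ⟨hu₁, hu₁a, hu₁b⟩ => ?_
  refine (rel_renewShares hN hA (isSharing_of_sixth hv₀) (isSharing_of_sixth hv₀') sv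
    ((hidden_sub hw hw' hww').congr (b := d' - d) (by rw [hd]; ring))).bind
    fun v₁ v₁' ⟨hv₁, hv₁a, hv₁b⟩ => ?_
  have huv : SameHeld A (u₀ * v₀) (u₀' * v₀') := fun i hi => by simp [su i hi, sv i hi]
  -- The output contains `δ • v + ε • w` with public `δ = b + d` and `ε = a + c`. The renewed
  -- product compensates the difference of these terms and adds the prescribed `Δ`.
  have hΔ' : Hidden A (deg N) (Δ + (b + d) • (v - v') + (a + c) • (w - w')) (c' * d' - c * d) :=
    ((hΔ.add ((hidden_sub hv hv' hvv').smul (b + d))).add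
      ((hidden_sub hw hw' hww').smul (a + c))).congr (by rw [hc, hd]; ring)
  refine (rel_renewShares hN hA (product_isSharing hu₀ hv₀) (product_isSharing hu₀' hv₀') huv
    hΔ').bind fun z z' ⟨hz, _, _⟩ => ?_
  have he1 : v' + u₁' = v + u₁ := by rw [hu₁]; abel
  have he2 : w' + v₁' = w + v₁ := by rw [hv₁]; abel
  rw [he1, he2]
  refine (rel_reconst hNp hN hA (PolyShares.add hv hu₁a)).bind fun ε ε' ⟨hε, hε'⟩ => ?_
  refine (rel_reconst hNp hN hA (PolyShares.add hw hv₁a)).bind fun δ δ' ⟨hδ, hδ'⟩ => Rel.pure ?_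
  rw [hz, hε, hε', hδ, hδ']
  module

/-- The form used when the product is not opened directly: any hidden `Δ` with the right secret will
do. -/
theorem rel_multiply_sameHeld (hNp : N < p) (hN : 0 < N) (hA : 6 * A.corrupt.card ≤ N)
    {v w v' w' : Shares p N} {a b a' b' : ZMod p} (hv : IsSharing v a) (hw : IsSharing w b)
    (hv' : IsSharing v' a') (hw' : IsSharing w' b') (hvv' : SameHeld A v v')
    (hww' : SameHeld A w w') :
    Rel (fun x y => SameHeld A x y ∧ IsSharing x (a * b) ∧ IsSharing y (a' * b'))
      (multiply A v w) (multiply A v' w') := by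
  obtain ⟨Δ, hΔ⟩ := exists_hidden (k := deg N) hNp A (by simp only [deg]; omega) (a' * b' - a * b)
  exact (rel_multiply hNp hN hA hv hw hv' hw' hvv' hww' hΔ).mono fun x y h =>
    ⟨h.1 ▸ hΔ.sameHeld_add x, h.2⟩

end Primitives

/-! ### Bits -/

section BitLists

/-- The number with the given binary digits, least significant first. -/
def natOfBits : List Bool → ℕ
  | [] => 0
  | b :: bs => b.toNat + 2 * natOfBits bs

/-- The digits in which a list of bits differs from the number `c`. -/
def xorBits : List Bool → ℕ → List Bool
  | [], _ => []
  | b :: bs, c => (b ^^ c.testBit 0) :: xorBits bs (c / 2)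

/-- The disjunctions of each bit with all more significant ones. -/
def suffixOr : List Bool → List Bool
  | [] => []
  | b :: bs => (b || bs.any id) :: suffixOr bs

/-- The indicators of the most significant `true`. -/
def topBit : List Bool → List Bool
  | [] => []
  | b :: bs => (b && !bs.any id) :: topBit bs

/-- The `n` lowest binary digits of a number. -/
def bitsOfNat : ℕ → ℕ → List Bool
  | 0, _ => []
  | n + 1, c => c.testBit 0 :: bitsOfNat n (c / 2)

theorem toNat_testBit_zero (c : ℕ) : (c.testBit 0).toNat = c % 2 := by
  rw [Nat.testBit_zero]
  rcases Nat.mod_two_eq_zero_or_one c with h | h <;> simp [h]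

theorem length_bitsOfNat (n c : ℕ) : (bitsOfNat n c).length = n := by
  induction n generalizing c with
  | zero => rfl
  | succ n ih => simp [bitsOfNat, ih]

theorem natOfBits_bitsOfNat {n c : ℕ} (h : c < 2 ^ n) : natOfBits (bitsOfNat n c) = c := by
  induction n generalizing c with
  | zero => simp [bitsOfNat, natOfBits]; omega
  | succ n ih =>
    rw [bitsOfNat, natOfBits, ih (by rw [pow_succ] at h; omega), toNat_testBit_zero]
    omega

theorem natOfBits_lt (bs : List Bool) : natOfBits bs < 2 ^ bs.length := by
  induction bs with
  | nil => simp [natOfBits]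
  | cons b bs ih =>
    rw [natOfBits, List.length_cons, pow_succ]
    have := b.toNat_le
    omega

theorem natOfBits_injective {bs bs' : List Bool} (hl : bs.length = bs'.length)
    (h : natOfBits bs = natOfBits bs') : bs = bs' := by
  induction bs generalizing bs' with
  | nil => exact (List.length_eq_zero_iff.1 hl.symm).symm
  | cons b bs ih =>
    rcases bs' with _ | ⟨b', bs'⟩
    · simp at hl
    · simp only [natOfBits] at h
      have h1 := b.toNat_le
      have h2 := b'.toNat_le
      have h3 : b.toNat = b'.toNat := by omega
      have h4 : b = b' := by cases b <;> cases b' <;> simp_all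
      rw [ih (by simpa using hl) (by omega), h4]

/-- The bound on `c` ensures that no digit of `c` lies beyond the list and goes uncompared. -/
theorem any_xorBits {bs : List Bool} {c : ℕ} (hc : c < 2 ^ bs.length) :
    (xorBits bs c).any id = true ↔ natOfBits bs ≠ c := by
  induction bs generalizing c with
  | nil => simp [xorBits, natOfBits] at hc ⊢; omega
  | cons b bs ih =>
    rw [List.length_cons, pow_succ] at hc
    have h1 := toNat_testBit_zero c
    simp only [xorBits, List.any_cons, Bool.or_eq_true, ih (c := c / 2) (by omega), id, natOfBits]
    cases b <;> cases h : c.testBit 0 <;> simp [h] at h1 ⊢ <;> omega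

end BitLists

section SharedBits

variable {p N : ℕ} [Fact p.Prime] {A : Adversary p N}

/-- `v` is a sharing of the bit `b`. -/
def IsBit (v : Shares p N) (b : Bool) : Prop := IsSharing v ((b.toNat : ℕ) : ZMod p)

theorem isBit_one_sub {v : Shares p N} {b : Bool} (h : IsBit v b) :
    IsBit (const 1 - v) (!b) := by
  refine ((polyShares_const _ 1).sub h).congr ?_
  cases b <;> simp

theorem isBit_xorPublic {v : Shares p N} {b : Bool} (h : IsBit v b) (c : Bool) :
    IsBit (xorPublic v c) (b ^^ c) := by
  unfold xorPublic
  cases c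
  · simpa using h
  · simpa using isBit_one_sub h

theorem sameHeld_xorPublic {v w : Shares p N} (h : SameHeld A v w) (c : Bool) :
    SameHeld A (xorPublic v c) (xorPublic w c) := by
  unfold xorPublic
  cases c
  · simpa using h
  · simpa using (SameHeld.refl _).sub h

/-- Entrywise sharings of bits. -/
abbrev AreBits (vs : List (Shares p N)) (bs : List Bool) : Prop := List.Forall₂ IsBit vs bs

theorem areBits_xorPublic {vs : List (Shares p N)} {bs : List Bool} (h : AreBits vs bs) (c : ℕ) :
    AreBits (vs.mapIdx fun i b => xorPublic b (c.testBit i)) (xorBits bs c) := by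
  induction h generalizing c with
  | nil => exact .nil
  | cons hv _ ih =>
    rw [List.mapIdx_cons]
    refine .cons (isBit_xorPublic hv _) ?_
    simpa only [Nat.testBit_succ] using ih (c / 2)

theorem sameHeld_mapIdx {vs ws : List (Shares p N)} (h : List.Forall₂ (SameHeld A) vs ws)
    (f : ℕ → Shares p N → Shares p N)
    (hf : ∀ i v w, SameHeld A v w → SameHeld A (f i v) (f i w)) :
    List.Forall₂ (SameHeld A) (vs.mapIdx f) (ws.mapIdx f) := by
  induction h generalizing f with
  | nil => exact .nil
  | cons hv _ ih =>
    rw [List.mapIdx_cons, List.mapIdx_cons]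
    exact .cons (hf _ _ _ hv) (ih _ fun i => hf (i + 1))

theorem sameHeld_sum {vs ws : List (Shares p N)} (h : List.Forall₂ (SameHeld A) vs ws) :
    SameHeld A vs.sum ws.sum := by
  induction h with
  | nil => exact SameHeld.refl _
  | cons hv _ ih =>
    rw [List.sum_cons, List.sum_cons]
    exact hv.add ih

/-- The differences of consecutive entries. -/
def adjacentDiff (ds : List (Shares p N)) : List (Shares p N) :=
  List.zipWith (fun d e => d - e) ds (ds.tail ++ [const 0])

theorem adjacentDiff_cons (d : Shares p N) (ds : List (Shares p N)) :
    adjacentDiff (d :: ds) = (d - ds.headD 0) :: adjacentDiff ds := by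
  rcases ds with _ | ⟨d', ds⟩ <;> rfl

theorem areBits_adjacentDiff {ds : List (Shares p N)} {bs : List Bool}
    (h : AreBits ds (suffixOr bs)) : AreBits (adjacentDiff ds) (topBit bs) := by
  induction bs generalizing ds with
  | nil =>
    rw [suffixOr, AreBits, List.forall₂_nil_right_iff] at h
    subst h
    exact .nil
  | cons b bs ih =>
    rcases h with _ | @⟨d, _, ds, _, hd, hds⟩
    rw [adjacentDiff_cons]
    refine .cons ?_ (ih hds)
    have htail : IsBit (ds.headD 0) (bs.any id) := by
      rcases bs with _ | ⟨b', bs⟩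
      · rw [suffixOr, List.forall₂_nil_right_iff] at hds
        subst hds
        exact (polyShares_zero _).congr (by simp)
      · rcases hds with _ | @⟨d', _, ds, _, hd', _⟩
        simpa [suffixOr] using hd'
    refine (PolyShares.sub hd htail).congr ?_
    cases b <;> cases bs.any id <;> simp

theorem sameHeld_adjacentDiff {ds es : List (Shares p N)} (h : List.Forall₂ (SameHeld A) ds es) :
    List.Forall₂ (SameHeld A) (adjacentDiff ds) (adjacentDiff es) := by
  induction h with
  | nil => exact .nil
  | @cons d e ds es hv h ih =>
    rw [adjacentDiff_cons, adjacentDiff_cons]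
    refine .cons (hv.sub ?_) ih
    rcases h with _ | ⟨hv', _⟩
    · exact SameHeld.refl _
    · exact hv'

/-- The sum of the entries selected by the binary digits of `c`. -/
def selectSum (c : ℕ) (es : List (Shares p N)) : Shares p N :=
  (es.mapIdx fun i e => if c.testBit i then e else const 0).sum

theorem selectSum_cons (c : ℕ) (e : Shares p N) (es : List (Shares p N)) :
    selectSum c (e :: es) = (if c.testBit 0 then e else const 0) + selectSum (c / 2) es := by
  rw [selectSum, List.mapIdx_cons, List.sum_cons]
  simp only [Nat.testBit_succ]
  rfl

/-- The number `c` is the larger one exactly if it has digit `1` at the most significant difference,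
and at most one indicator is set, so the sum is a bit. The induction removes the lowest digit and
replaces `c` by `c / 2`. -/
theorem isBit_selectSum {bs : List Bool} {c : ℕ} (hc : c < 2 ^ bs.length)
    {es : List (Shares p N)} (h : AreBits es (topBit (xorBits bs c))) :
    IsBit (selectSum c es) (decide (natOfBits bs < c)) := by
  induction bs generalizing c es with
  | nil =>
    rw [xorBits, topBit, AreBits, List.forall₂_nil_right_iff] at h
    subst h
    exact (polyShares_zero _).congr (by simp [natOfBits] at hc ⊢; simp [hc])
  | cons b bs ih =>
    rw [List.length_cons, pow_succ] at hc
    rcases h with _ | @⟨e, _, es, _, he, hes⟩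
    rw [selectSum_cons]
    have hc' : c / 2 < 2 ^ bs.length := by omega
    have h1 := ih hc' hes
    have hany : (xorBits bs (c / 2)).any id = decide (natOfBits bs ≠ c / 2) := by
      rw [Bool.eq_iff_iff, any_xorBits hc']; simp
    rw [hany] at he
    have h2 := toNat_testBit_zero c
    have hsum : IsSharing (if c.testBit 0 then e else const 0)
        ((((b ^^ c.testBit 0) && !decide (natOfBits bs ≠ c / 2)) && c.testBit 0).toNat : ZMod p) := by
      cases hc0 : c.testBit 0
      · exact (polyShares_const _ 0).congr (by simp)
      · rw [hc0] at he
        exact PolyShares.congr he (by simp)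
    refine (PolyShares.add hsum h1).congr ?_
    rw [← Nat.cast_add]
    congr 1
    rw [natOfBits]
    -- The higher digits decide unless they agree; only then does the lowest digit count.
    rcases lt_trichotomy (natOfBits bs) (c / 2) with hlt | heq | hgt
    · have : b.toNat + 2 * natOfBits bs < c := by have := b.toNat_le; omega
      simp [hlt, hlt.ne, this]
    · have hd : decide (b.toNat + 2 * natOfBits bs < c) = decide (b.toNat < (c.testBit 0).toNat) :=
        decide_eq_decide.2 (by omega)
      rw [hd]
      cases b <;> rcases Bool.eq_false_or_eq_true (c.testBit 0) with h | h <;>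
        simp only [heq, h] <;> simp
    · have : ¬ b.toNat + 2 * natOfBits bs < c := by omega
      simp [hgt.ne', hgt.not_gt, this]

/-- Mirror image of `isBit_selectSum`: the shared number is the larger one exactly if its own digit
at the top difference is `1`. That digit is secret, hence the products in place of a public
selection. -/
theorem isBit_sum_and {bs : List Bool} {c : ℕ} (hc : c < 2 ^ bs.length) {ms : List (Shares p N)}
    (h : AreBits ms (List.zipWith (· && ·) (topBit (xorBits bs c)) bs)) :
    IsBit ms.sum (decide (c < natOfBits bs)) := by
  induction bs generalizing c ms with
  | nil =>
    rw [List.zipWith_nil_right, AreBits, List.forall₂_nil_right_iff] at h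
    subst h
    exact (polyShares_zero _).congr (by simp [natOfBits])
  | cons b bs ih =>
    rw [List.length_cons, pow_succ] at hc
    rcases h with _ | @⟨e, _, es, _, he, hes⟩
    have hc' : c / 2 < 2 ^ bs.length := by omega
    have h1 := ih hc' hes
    have hany : (xorBits bs (c / 2)).any id = decide (natOfBits bs ≠ c / 2) := by
      rw [Bool.eq_iff_iff, any_xorBits hc']; simp
    rw [hany] at he
    have h2 := toNat_testBit_zero c
    rw [List.sum_cons]
    refine (PolyShares.add he h1).congr ?_
    rw [← Nat.cast_add]
    congr 1
    rw [natOfBits]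
    rcases lt_trichotomy (natOfBits bs) (c / 2) with hlt | heq | hgt
    · have : ¬ c < b.toNat + 2 * natOfBits bs := by have := b.toNat_le; omega
      simp [hlt.ne, hlt.not_gt, this]
    · have hd : decide (c < b.toNat + 2 * natOfBits bs) = decide ((c.testBit 0).toNat < b.toNat) :=
        decide_eq_decide.2 (by omega)
      rw [hd]
      cases b <;> rcases Bool.eq_false_or_eq_true (c.testBit 0) with h | h <;>
        simp only [heq, h] <;> simp
    · have : c < b.toNat + 2 * natOfBits bs := by omega
      simp [hgt, hgt.ne', this]

theorem recompose_cons (b : Shares p N) (bs : List (Shares p N)) :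
    recompose (b :: bs) = b + (2 : ZMod p) • recompose bs := by
  rw [recompose, List.mapIdx_cons, List.sum_cons, pow_zero, one_smul, recompose, List.smul_sum]
  congr 2
  refine List.ext_getElem (by simp) fun i h h' => ?_
  simp [pow_succ', mul_smul]

theorem isSharing_recompose {vs : List (Shares p N)} {bs : List Bool} (h : AreBits vs bs) :
    IsSharing (recompose vs) (natOfBits bs : ZMod p) := by
  induction h with
  | nil => exact (polyShares_zero _).congr (by simp [natOfBits])
  | cons hv _ ih =>
    rw [recompose_cons]
    refine (PolyShares.add hv (PolyShares.smul 2 ih)).congr ?_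
    simp [natOfBits]

end SharedBits

/-! ### Comparison with a public number -/

section PublicComparison

variable {p N : ℕ} [Fact p.Prime] {A : Adversary p N}

/-- The standing assumptions on the quorum. -/
structure IsQuorum (A : Adversary p N) : Prop where
  odd : p ≠ 2
  lt : N < p
  pos : 0 < N
  few : 6 * A.corrupt.card ≤ N

theorem IsQuorum.deg_lt (hQ : IsQuorum A) : deg N < N := Nat.div_lt_self hQ.pos (by norm_num)

theorem IsQuorum.unique (hQ : IsQuorum A) {v : Shares p N} {a b : ZMod p} (h : IsSharing v a)
    (h' : IsSharing v b) : a = b := PolyShares.unique hQ.lt hQ.deg_lt h h'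

theorem IsQuorum.bit_unique (hQ : IsQuorum A) {v : Shares p N} {a b : Bool} (h : IsBit v a)
    (h' : IsBit v b) : a = b := by
  have := hQ.unique h h'
  cases a <;> cases b <;> simp at this ⊢

theorem IsQuorum.bits_unique (hQ : IsQuorum A) {vs : List (Shares p N)} {a b : List Bool}
    (h : AreBits vs a) (h' : AreBits vs b) : a = b := by
  induction h generalizing b with
  | nil => rcases h' with _ | _; rfl
  | cons hv _ ih =>
    rcases h' with _ | ⟨hv', h'⟩
    rw [hQ.bit_unique hv hv', ih h']

theorem IsQuorum.exists_hidden (hQ : IsQuorum A) (a : ZMod p) :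
    ∃ Δ, Hidden A (deg N) Δ a := by
  have := hQ.few
  exact ObliviousGate.exists_hidden hQ.lt A (by simp only [deg]; omega) a

theorem ensures_multiply_bits (hQ : IsQuorum A) {v w : Shares p N} {a b : Bool} (hv : IsBit v a)
    (hw : IsBit w b) : Ensures (fun x => IsBit x (a && b)) 0 (multiply A v w) :=
  (ensures_multiply hQ.lt hQ.pos hQ.few hv hw).weaken fun x hx => PolyShares.congr hx (by
    cases a <;> cases b <;> simp)

theorem isBit_or {v w m : Shares p N} {a b : Bool} (hv : IsBit v a) (hw : IsBit w b)
    (hm : IsBit m (a && b)) : IsBit (v + w - m) (a || b) :=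
  ((PolyShares.add hv hw).sub hm).congr (by cases a <;> cases b <;> simp)

theorem isBit_xor {v w m : Shares p N} {a b : Bool} (hv : IsBit v a) (hw : IsBit w b)
    (hm : IsBit m (a && b)) : IsBit (v + w - (2 : ZMod p) • m) (a ^^ b) :=
  ((PolyShares.add hv hw).sub (PolyShares.smul 2 hm)).congr (by
    cases a <;> cases b <;> simp; norm_num)

theorem suffixOr_eq_cons {bs : List Bool} {d : Shares p N} {ds : List (Shares p N)}
    (h : AreBits (d :: ds) (suffixOr bs)) :
    IsBit d (bs.any id) ∧ ∃ b bs', bs = b :: bs' ∧ AreBits ds (suffixOr bs') := by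
  rcases bs with _ | ⟨b, bs⟩
  · cases h
  · rcases h with _ | ⟨hd, hds⟩
    exact ⟨by simpa using hd, b, bs, rfl, hds⟩

theorem ensures_prefixOr (hQ : IsQuorum A) {cs : List (Shares p N)} {bs : List Bool}
    (h : AreBits cs bs) : Ensures (fun ds => AreBits ds (suffixOr bs)) 0 (prefixOr A cs) := by
  induction h with
  | nil => exact Ensures.pure .nil
  | @cons c b cs bs hc hcs ih =>
    rw [prefixOr]
    refine ih.bind_zero fun ds hds => ?_
    rcases ds with _ | ⟨d, ds⟩
    · rcases bs with _ | ⟨b', bs⟩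
      · exact Ensures.pure (.cons (by simpa using hc) .nil)
      · cases hds
    · obtain ⟨hd, -⟩ := suffixOr_eq_cons hds
      exact (ensures_multiply_bits hQ hc hd).bind_zero fun m hm =>
        Ensures.pure (.cons (isBit_or hc hd hm) hds)

theorem rel_prefixOr (hQ : IsQuorum A) {cs cs' : List (Shares p N)} {bs bs' : List Bool}
    (h : AreBits cs bs) (h' : AreBits cs' bs') (hcs : List.Forall₂ (SameHeld A) cs cs') :
    Rel (fun ds ds' => List.Forall₂ (SameHeld A) ds ds' ∧ AreBits ds (suffixOr bs) ∧
      AreBits ds' (suffixOr bs')) (prefixOr A cs) (prefixOr A cs') := by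
  refine Rel.and_ensures ?_ (ensures_prefixOr hQ h) ENNReal.zero_ne_top
    (ensures_prefixOr hQ h') ENNReal.zero_ne_top
  induction hcs generalizing bs bs' with
  | nil => exact Rel.pure .nil
  | @cons c c' cs cs' hc hcs ih =>
    rcases h with _ | ⟨hcb, h⟩
    rcases h' with _ | ⟨hcb', h'⟩
    rw [prefixOr, prefixOr]
    refine ((ih h h').and_ensures (ensures_prefixOr hQ h) ENNReal.zero_ne_top
      (ensures_prefixOr hQ h') ENNReal.zero_ne_top).bind fun ds ds' ⟨hs, hds, hds'⟩ => ?_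
    rcases hs with _ | ⟨hd, hs⟩
    · exact Rel.pure (.cons hc .nil)
    · have hd1 := (suffixOr_eq_cons hds).1
      have hd2 := (suffixOr_eq_cons hds').1
      exact (rel_multiply_sameHeld hQ.lt hQ.pos hQ.few hcb hd1 hcb' hd2 hc hd).bind
        fun m m' hm => Rel.pure (.cons ((hc.add hd).sub hm.1) (.cons hd hs))

/-- The head of the list of prefix disjunctions is as random as the dishonest shares and the secret
permit. -/
theorem rel_prefixOr_head (hQ : IsQuorum A) {c c' : Shares p N} {cs cs' : List (Shares p N)}
    {b b' : Bool} {bs bs' : List Bool} (hne : cs ≠ []) (hc : IsBit c b) (hc' : IsBit c' b')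
    (h : AreBits cs bs) (h' : AreBits cs' bs') (hcc : SameHeld A c c')
    (hcs : List.Forall₂ (SameHeld A) cs cs') (Ψ : List (Shares p N) → Shares p N)
    (hΨ : ∀ t t', List.Forall₂ (SameHeld A) t t' → AreBits t (suffixOr bs) →
      AreBits t' (suffixOr bs') → SameHeld A (Ψ t) (Ψ t') ∧ ∃ s s', IsSharing (Ψ t) s ∧
        IsSharing (Ψ t') s' ∧
        (((b || bs.any id).toNat : ℕ) : ZMod p) + s = (((b' || bs'.any id).toNat : ℕ) : ZMod p) + s') :
    Rel (fun ds ds' => ∃ x t x' t', ds = x :: t ∧ ds' = x' :: t' ∧ x + Ψ t = x' + Ψ t')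
      (prefixOr A (c :: cs)) (prefixOr A (c' :: cs')) := by
  rw [prefixOr, prefixOr]
  refine (rel_prefixOr hQ h h' hcs).bind fun ds ds' ⟨hs, hds, hds'⟩ => ?_
  obtain ⟨hΨs, s, s', hs1, hs2, hss⟩ := hΨ ds ds' hs hds hds'
  rcases hs with _ | @⟨d, d', ds, ds', hd, hs⟩
  · rcases hcs with _ | _
    · exact absurd rfl hne
    · rcases h with _ | _
      cases hds
  · have hd1 := (suffixOr_eq_cons hds).1
    have hd2 := (suffixOr_eq_cons hds').1
    -- The head is `c + d - m`, so equality of the two sums `head + Ψ` dictates precisely this shift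
    -- of the product `m`. Such a product exists only if the tail is nonempty.
    have hΔ : Hidden A (deg N) ((c' - c) + (d' - d) + (Ψ (d' :: ds') - Ψ (d :: ds)))
        ((b'.toNat : ZMod p) * ((bs'.any id).toNat : ZMod p) -
          (b.toNat : ZMod p) * ((bs.any id).toNat : ZMod p)) := by
      refine (((hidden_sub hc' hc hcc.symm).add (hidden_sub hd2 hd1 hd.symm)).add
        (hidden_sub hs2 hs1 hΨs.symm)).congr ?_
      have e1 : s' - s = (((b || bs.any id).toNat : ℕ) : ZMod p) -
          (((b' || bs'.any id).toNat : ℕ) : ZMod p) := by linear_combination -hss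
      rw [e1]
      cases b <;> cases b' <;> cases bs.any id <;> cases bs'.any id <;> simp
    refine (rel_multiply hQ.lt hQ.pos hQ.few hc hd1 hc' hd2 hcc hd hΔ).bind
      fun m m' hm => Rel.pure ⟨_, _, _, _, rfl, rfl, ?_⟩
    rw [hm.1]
    abel

theorem sameHeld_xorList {vs ws : List (Shares p N)} (h : List.Forall₂ (SameHeld A) vs ws) (c : ℕ) :
    List.Forall₂ (SameHeld A) (vs.mapIdx fun i b => xorPublic b (c.testBit i))
      (ws.mapIdx fun i b => xorPublic b (c.testBit i)) :=
  sameHeld_mapIdx h _ fun _ _ _ hv => sameHeld_xorPublic hv _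

theorem sameHeld_selectSum (c : ℕ) {vs ws : List (Shares p N)}
    (h : List.Forall₂ (SameHeld A) vs ws) : SameHeld A (selectSum c vs) (selectSum c ws) :=
  sameHeld_sum (sameHeld_mapIdx h _ fun i v w hv => by
    split_ifs
    · exact hv
    · exact SameHeld.refl _)

theorem ensures_firstDifference (hQ : IsQuorum A) {vs : List (Shares p N)} {bs : List Bool}
    (h : AreBits vs bs) (c : ℕ) :
    Ensures (fun es => AreBits es (topBit (xorBits bs c))) 0 (firstDifference A vs c) :=
  (ensures_prefixOr hQ (areBits_xorPublic h c)).bind_zero fun _ hds =>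
    Ensures.pure (areBits_adjacentDiff hds)

theorem rel_firstDifference (hQ : IsQuorum A) {vs ws : List (Shares p N)} {bs bs' : List Bool}
    (h : AreBits vs bs) (h' : AreBits ws bs') (hs : List.Forall₂ (SameHeld A) vs ws) (c : ℕ) :
    Rel (fun es es' => List.Forall₂ (SameHeld A) es es' ∧ AreBits es (topBit (xorBits bs c)) ∧
      AreBits es' (topBit (xorBits bs' c))) (firstDifference A vs c) (firstDifference A ws c) :=
  (rel_prefixOr hQ (areBits_xorPublic h c) (areBits_xorPublic h' c) (sameHeld_xorList hs c)).bind
    fun _ _ hds => Rel.pure ⟨sameHeld_adjacentDiff hds.1, areBits_adjacentDiff hds.2.1,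
      areBits_adjacentDiff hds.2.2⟩

theorem ensures_ltPublic (hQ : IsQuorum A) {vs : List (Shares p N)} {bs : List Bool}
    (h : AreBits vs bs) {c : ℕ} (hc : c < 2 ^ bs.length) :
    Ensures (fun v => IsBit v (decide (natOfBits bs < c))) 0 (ltPublic A vs c) :=
  (ensures_firstDifference hQ h c).bind_zero fun _ hes => Ensures.pure (isBit_selectSum hc hes)

/-- If the public number is odd and has at least two digits then the outcome of `ltPublic` may be
opened: it is as random as the dishonest shares and the secret permit. -/
theorem rel_ltPublic (hQ : IsQuorum A) {vs ws : List (Shares p N)} {bs bs' : List Bool}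
    (h : AreBits vs bs) (h' : AreBits ws bs') (hs : List.Forall₂ (SameHeld A) vs ws) {c : ℕ}
    (hc : c < 2 ^ bs.length) (hc0 : c.testBit 0 = true) (hlen : 2 ≤ bs.length)
    (hlt : natOfBits bs < c ↔ natOfBits bs' < c) :
    Rel Eq (ltPublic A vs c) (ltPublic A ws c) := by
  have hl : bs.length = bs'.length := by rw [← h.length_eq, ← h'.length_eq, hs.length_eq]
  have hx := areBits_xorPublic h c
  have hx' := areBits_xorPublic h' c
  have hxs := sameHeld_xorList hs c
  have hlt' : decide (natOfBits bs < c) = decide (natOfBits bs' < c) := decide_eq_decide.2 hlt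
  rcases bs with _ | ⟨b, bs⟩
  · simp at hlen
  rcases bs' with _ | ⟨b', bs'⟩
  · simp at hl
  let Φ : List (Shares p N) → Shares p N := fun ds => selectSum c (adjacentDiff ds)
  -- As `c` is odd, the lowest indicator is selected, and the lowest disjunction occurs only in it.
  have hΦ : ∀ d ds, Φ (d :: ds) = d + Φ (0 :: ds) := by
    intro d ds
    simp only [Φ, adjacentDiff_cons, selectSum_cons, hc0, if_true]
    abel
  have key : ∀ (β : Bool) (βs : List Bool), c < 2 ^ (β :: βs).length → ∀ t,
      AreBits t (suffixOr (xorBits βs (c / 2))) →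
      IsSharing (Φ (0 :: t)) (((decide (natOfBits (β :: βs) < c)).toNat : ZMod p) -
        (((β ^^ c.testBit 0) || (xorBits βs (c / 2)).any id).toNat : ZMod p)) := by
    intro β βs hβ t ht
    -- The secret of `Φ (0 :: t)` is found by inserting the correct disjunction as a constant at the
    -- head, applying `isBit_selectSum`, and subtracting the constant again.
    have h1 : IsBit (Φ (const _ :: t)) _ := isBit_selectSum (bs := β :: βs) hβ
      (areBits_adjacentDiff (List.Forall₂.cons (polyShares_const _ _) ht))
    rw [hΦ] at h1
    have h2 := PolyShares.sub h1 (polyShares_const (deg N)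
      (((β ^^ c.testBit 0) || (xorBits βs (c / 2)).any id).toNat : ZMod p))
    rwa [add_sub_cancel_left] at h2
  have main : Rel (fun ds ds' => Φ ds = Φ ds')
      (prefixOr A (vs.mapIdx fun i b => xorPublic b (c.testBit i)))
      (prefixOr A (ws.mapIdx fun i b => xorPublic b (c.testBit i))) := by
    generalize vs.mapIdx (fun i b => xorPublic b (c.testBit i)) = xs at hx hxs
    generalize ws.mapIdx (fun i b => xorPublic b (c.testBit i)) = ys at hx' hxs
    rcases hx with _ | @⟨x, _, xs, _, hx1, hx⟩
    rcases hx' with _ | @⟨y, _, ys, _, hy1, hy⟩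
    rcases hxs with _ | ⟨hxy, hxs⟩
    refine (rel_prefixOr_head hQ ?_ hx1 hy1 hx hy hxy hxs (fun t => Φ (0 :: t)) ?_).mono ?_
    · rintro rfl
      rcases bs with _ | ⟨b₁, bs⟩
      · simp at hlen
      · cases hx
    · intro t t' htt ht ht'
      refine ⟨sameHeld_selectSum c (sameHeld_adjacentDiff (.cons (SameHeld.refl _) htt)), _, _,
        key b bs hc t ht, key b' bs' (hl ▸ hc) t' ht', ?_⟩
      rw [hlt']
      ring
    · rintro ds ds' ⟨x, t, x', t', rfl, rfl, hxt⟩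
      rw [hΦ x, hΦ x', hxt]
  exact (main.bind (S := fun es es' => selectSum c es = selectSum c es')
    fun ds ds' hds => Rel.pure hds).bind fun es es' hes => Rel.pure hes

theorem ensures_multiply_zip (hQ : IsQuorum A) {vs ws : List (Shares p N)} {bs bs' : List Bool}
    (h : AreBits vs bs) (h' : AreBits ws bs') :
    Ensures (fun ms => AreBits ms (List.zipWith (· && ·) bs bs')) 0
      ((List.zip vs ws).mapM fun eb => multiply A eb.1 eb.2) := by
  induction h generalizing ws bs' with
  | nil => exact Ensures.pure .nil
  | cons hv _ ih =>
    rcases h' with _ | ⟨hw, h'⟩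
    · exact Ensures.pure .nil
    · rw [List.zip_cons_cons, List.mapM_cons]
      exact (ensures_multiply_bits hQ hv hw).bind_zero fun y hy =>
        (ih h').bind_zero fun ys hys => Ensures.pure (.cons hy hys)

theorem rel_multiply_zip (hQ : IsQuorum A) {vs ws vs' ws' : List (Shares p N)}
    {bs cs bs' cs' : List Bool} (h : AreBits vs bs) (h' : AreBits ws cs) (h'' : AreBits vs' bs')
    (h''' : AreBits ws' cs') (hv : List.Forall₂ (SameHeld A) vs vs')
    (hw : List.Forall₂ (SameHeld A) ws ws') :
    Rel (List.Forall₂ (SameHeld A)) ((List.zip vs ws).mapM fun eb => multiply A eb.1 eb.2)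
      ((List.zip vs' ws').mapM fun eb => multiply A eb.1 eb.2) := by
  induction hv generalizing ws ws' bs bs' cs cs' with
  | nil => exact Rel.pure .nil
  | cons hvv _ ih =>
    rcases hw with _ | ⟨hww, hw⟩
    · exact Rel.pure .nil
    · rcases h with _ | ⟨hb, h⟩
      rcases h' with _ | ⟨hb', h'⟩
      rcases h'' with _ | ⟨hb'', h''⟩
      rcases h''' with _ | ⟨hb''', h'''⟩
      rw [List.zip_cons_cons, List.mapM_cons, List.zip_cons_cons, List.mapM_cons]
      exact (rel_multiply_sameHeld hQ.lt hQ.pos hQ.few hb hb' hb'' hb''' hvv hww).bind fun y y' hy =>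
        (ih h h' h'' h''' hw).bind fun ys ys' hys => Rel.pure (.cons hy.1 hys)

theorem ensures_publicLt (hQ : IsQuorum A) {vs : List (Shares p N)} {bs : List Bool}
    (h : AreBits vs bs) {c : ℕ} (hc : c < 2 ^ bs.length) :
    Ensures (fun v => IsBit v (decide (c < natOfBits bs))) 0 (publicLt A c vs) :=
  (ensures_firstDifference hQ h c).bind_zero fun _ hes =>
    (ensures_multiply_zip hQ hes h).bind_zero fun _ hms => Ensures.pure (isBit_sum_and hc hms)

theorem rel_publicLt (hQ : IsQuorum A) {vs ws : List (Shares p N)} {bs bs' : List Bool}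
    (h : AreBits vs bs) (h' : AreBits ws bs') (hs : List.Forall₂ (SameHeld A) vs ws) {c : ℕ}
    (hc : c < 2 ^ bs.length) :
    Rel (fun v w => SameHeld A v w ∧ IsBit v (decide (c < natOfBits bs)) ∧
      IsBit w (decide (c < natOfBits bs'))) (publicLt A c vs) (publicLt A c ws) := by
  have hl : bs.length = bs'.length := by rw [← h.length_eq, ← h'.length_eq, hs.length_eq]
  refine Rel.and_ensures ?_ (ensures_publicLt hQ h hc) ENNReal.zero_ne_top
    (ensures_publicLt hQ h' (hl ▸ hc)) ENNReal.zero_ne_top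
  exact (rel_firstDifference hQ h h' hs c).bind fun _ _ hes =>
    (rel_multiply_zip hQ hes.2.1 h hes.2.2 h' hes.1 hs).bind fun _ _ hms =>
      Rel.pure (sameHeld_sum hms)

end PublicComparison

/-! ### Random bits -/

section Attempts

variable {p N : ℕ} {α β : Type}

theorem exec_bind_apply_some [DecidableEq (Option β)] [DecidableEq (List (Event p N))]
    (m : Proto p N α) (f : α → Proto p N β) (b : β) (view v : List (Event p N)) :
    (m >>= f).exec view (some b, v) = wp m view fun o w =>
      match o with
      | none => 0
      | some a => (f a).exec w (some b, v) := by
  rw [exec_apply, wp_bind]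
  congr 1
  funext o w
  rcases o with _ | a
  · simp [wpBind]
  · exact (exec_apply _ _ _ _).symm

open Classical in
/-- The indicator of `P`. -/
def indicates (P : α → Prop) : Option α → ENNReal
  | none => 0
  | some a => if P a then 1 else 0

/-- A self-coupling that carries `P` into its complement makes `P` at most as likely as the
complement, and the two probabilities add up to at most `1`. -/
theorem wp_indicates_le_half {m : Proto p N α} {P : α → Prop} (h : Rel (fun a b => P a → ¬ P b) m m)
    (view : List (Event p N)) : wp m view (fun o _ => indicates P o) ≤ 2⁻¹ := by
  have h1 : wp m view (fun o _ => indicates P o) ≤ wp m view (fun o _ => indicates (fun a => ¬ P a) o) :=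
    h view _ _ (fun _ => le_rfl) fun a b _ hab => by
      by_cases ha : P a
      · simp [indicates, ha, hab ha]
      · simp [indicates, ha]
  refine le_half_of_le_of_add_le h1 ?_
  rw [wp, wp, ← expect_add]
  refine (expect_mono _ fun z => ?_).trans (expect_const _ 1).le
  rcases z with ⟨_ | a, v⟩
  · simp [indicates]
  · by_cases ha : P a <;> simp [indicates, ha]

open Classical in
/-- An attempt that is only rejected in the event `P` is rejected with probability at most `1 / 2`
if `P` can be coupled with its complement. -/
theorem wp_rejected_le_half {m : Proto p N α} {f : α → Proto p N (Option β)} {P Q : α → Prop}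
    {c : ENNReal} (hc : c ≠ ⊤) (hm : Ensures Q c m) (h : Rel (fun a b => P a → ¬ P b) m m)
    (hf : ∀ a, Q a → ¬ P a → Ensures (fun o => o ≠ none) 0 (f a)) (view : List (Event p N)) :
    wp (m >>= f) view (fun o _ => if o = some none then 1 else 0) ≤ 2⁻¹ := by
  rw [wp_bind]
  refine le_trans (hm.wp_le hc ?_ ?_ view) (wp_indicates_le_half h view)
  · intro v
    simp [wpBind, indicates]
  · intro a v ha
    by_cases hP : P a
    · rw [indicates, if_pos hP]
      refine (expect_mono _ fun z => ?_).trans (expect_const _ 1).le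
      dsimp only
      split_ifs <;> simp
    · rw [indicates, if_neg hP]
      refine ((hf a ha hP).wp_le (F := fun o _ => if o = some none then 1 else 0)
        (G := fun _ _ => 0) ENNReal.zero_ne_top ?_ ?_ v).trans ?_
      · simp
      · intro o w ho
        simp [ho]
      · simp [wp, expect]

theorem ensures_mapM_const {P : β → Prop} {c : ENNReal} {m : Proto p N β} (h : Ensures P c m)
    (l : List α) :
    Ensures (fun ys => ys.length = l.length ∧ ∀ y ∈ ys, P y) (l.length * c)
      (l.mapM fun _ => m) := by
  induction l with
  | nil =>
    rw [List.mapM_nil]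
    simpa using Ensures.pure (p := p) (N := N)
      (P := fun ys : List β => ys.length = 0 ∧ ∀ y ∈ ys, P y) (a := []) (by simp)
  | cons a l ih =>
    rw [List.mapM_cons]
    refine Ensures.mono (h.bind fun y hy => ih.bind_zero_right fun ys hys => Ensures.pure
      (P := fun ys : List β => ys.length = (a :: l).length ∧ ∀ y ∈ ys, P y) ?_) (fun _ h => h) ?_
    · simpa [hys.1, hy] using hys.2
    · rw [List.length_cons, Nat.cast_succ, add_mul, one_mul, add_comm]

/-- Given the final list, the outcome of each draw is known, so the comparison for one draw is
applied entry by entry, for every intermediate view. -/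
theorem exec_mapM_const_le {R : β → β → Prop} {m : Proto p N β}
    (h : ∀ y y', R y y' → ∀ view v, m.exec view (some y, v) ≤ m.exec view (some y', v))
    (l : List α) {ys ys' : List β} (hy : List.Forall₂ R ys ys') (view v : List (Event p N)) :
    (l.mapM fun _ => m).exec view (some ys, v) ≤ (l.mapM fun _ => m).exec view (some ys', v) := by
  classical
  induction l generalizing ys ys' view with
  | nil =>
    rw [List.mapM_nil]
    rcases hy with _ | _
    · exact le_rfl
    · rw [exec_apply, wp_pure]
      simp
  | cons a l ih =>
    rw [List.mapM_cons, exec_bind_apply_some, exec_bind_apply_some]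
    rcases hy with _ | @⟨y, y', ys, ys', hyy, hys⟩
    · exact le_rfl
    · have hcons : ∀ (x z : β) (xs : List β) (w : List (Event p N)), x = z →
          ((l.mapM fun _ => m) >>= fun ys => pure (x :: ys)).exec w (some (z :: xs), v) =
            (l.mapM fun _ => m).exec w (some xs, v) := by
        rintro x _ xs w rfl
        rw [exec_apply, wp_bind, exec_apply]
        congr 1
        funext o u
        rcases o with _ | zs
        · simp [wpBind]
        · simp [wpBind, wp_pure]
      refine wp_le_of_injOn m view {y} (fun _ => y') (Set.injOn_singleton _ _) ?_ ?_ ?_ ?_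
      · rintro _ rfl w
        exact h _ _ hyy view w
      · intro w; exact le_rfl
      · rintro _ rfl w
        dsimp only
        rw [hcons _ _ _ _ rfl, hcons _ _ _ _ rfl]
        exact ih hys w
      · intro x hx w
        dsimp only
        rw [Rel.exec_eq_zero (R := fun zs _ => zs ≠ y :: ys) ((Rel.refl _).bind
          (f₂ := fun ys => pure (x :: ys)) fun zs _ _ => Rel.pure ?_) fun _ _ h => h, mul_zero]
        exact fun h => hx (List.cons.inj h).1

end Attempts

/-! ### Exchangeability of shared random bits. -/

section RandomBit

variable {p N : ℕ} [Fact p.Prime] {A : Adversary p N}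

/-- One of `s` and `-s` has its representative in the lower half. Beyond this equation, the later
arguments use only that the chosen root is a function of the square. -/
theorem smallRoot_sq (s : ZMod p) : smallRoot (s * s) ^ 2 = s * s := by
  classical
  have h : ∃ t : ZMod p, t.val ≤ p / 2 ∧ t ^ 2 = s * s := by
    by_cases hs : s.val ≤ p / 2
    · exact ⟨s, hs, by ring⟩
    · refine ⟨-s, ?_, by ring⟩
      rw [ZMod.neg_val]
      split_ifs <;> omega
  have : smallRoot (s * s) = h.choose := by
    unfold smallRoot
    convert dif_pos h
  rw [this]
  exact h.choose_spec.2

theorem smallRoot_ne_zero {s : ZMod p} (hs : s ≠ 0) : smallRoot (s * s) ≠ 0 := by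
  intro h
  have := smallRoot_sq s
  rw [h] at this
  simp at this
  exact hs this

theorem IsQuorum.two_ne_zero (hQ : IsQuorum A) : (2 : ZMod p) ≠ 0 := by
  have : Fact (2 < p) := ⟨lt_of_le_of_ne (Fact.out : p.Prime).two_le hQ.odd.symm⟩
  exact_mod_cast (ZMod.prime_ne_zero p 2 : _) hQ.odd

/-- The continuation of an attempt at a random bit. -/
def bitFrom (A : Adversary p N) (r : Shares p N) : Proto p N (Option (Shares p N)) := do
  let sq ← multiply A r r
  let a ← reconst A sq
  if a = 0 then pure none
  else pure (some ((2 : ZMod p)⁻¹ • ((smallRoot a)⁻¹ • r + const 1)))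

theorem randBit_eq (A : Adversary p N) (K : ℕ) :
    randBit A K = retry K (genRand A (deg N) >>= bitFrom A) := rfl

theorem ensures_bitFrom (hQ : IsQuorum A) {r : Shares p N} {s : ZMod p} (hr : IsSharing r s) :
    Ensures (fun o => (s = 0 ∧ o = none) ∨
      (s ≠ 0 ∧ o = some ((2 : ZMod p)⁻¹ • ((smallRoot (s * s))⁻¹ • r + const 1)))) 0
      (bitFrom A r) := by
  refine (ensures_multiply hQ.lt hQ.pos hQ.few hr hr).bind_zero fun q hq => ?_
  refine (ensures_reconst hQ.lt hQ.pos hQ.few hq).bind_zero fun a ha => ?_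
  subst ha
  by_cases hs : s = 0
  · simp only [hs, mul_zero, if_true]
    exact Ensures.pure (Or.inl (by simp))
  · rw [if_neg (by simpa using hs)]
    exact Ensures.pure (Or.inr ⟨hs, rfl⟩)

theorem isBit_of_root (hQ : IsQuorum A) {r : Shares p N} {s t : ZMod p} (hr : IsSharing r s)
    (ht : t ≠ 0) (hts : t ^ 2 = s * s) :
    ∃ b, IsBit ((2 : ZMod p)⁻¹ • (t⁻¹ • r + const 1)) b := by
  have h := PolyShares.smul (2 : ZMod p)⁻¹ ((PolyShares.smul t⁻¹ hr).add (polyShares_const _ 1))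
  have h2 := hQ.two_ne_zero
  rcases sq_eq_sq_iff_eq_or_eq_neg.1 (hts.trans (sq s).symm) with rfl | rfl
  · exact ⟨true, h.congr (by rw [inv_mul_cancel₀ ht]; norm_num [h2])⟩
  · refine ⟨false, h.congr ?_⟩
    have hs : s ≠ 0 := by simpa using ht
    rw [inv_neg, neg_mul, inv_mul_cancel₀ hs]
    simp

theorem ensures_bitAttempt (hQ : IsQuorum A) :
    Ensures (fun o => ∀ v, o = some v → ∃ b, IsBit v b) 0 (genRand A (deg N) >>= bitFrom A) := by
  refine (ensures_genRand _).bind_zero fun r ⟨s, hr⟩ => (ensures_bitFrom hQ hr).weaken ?_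
  rintro _ (⟨_, rfl⟩ | ⟨hs, rfl⟩) v hv
  · simp at hv
  · cases hv
    exact isBit_of_root hQ hr (smallRoot_ne_zero hs) (smallRoot_sq s)

theorem ensures_randBit (hQ : IsQuorum A) (K : ℕ) :
    Ensures (fun v => ∃ b, IsBit v b) (2⁻¹ ^ K) (randBit A K) := by
  rw [randBit_eq]
  have h := (ensures_bitAttempt hQ).retry (P := fun v => ∃ b, IsBit v b) ?_ K
  · simpa using h
  intro view
  -- Rejection means that the secret is `0`; adding a hidden sharing of `1` leaves this event.
  obtain ⟨Λ, hΛ⟩ := hQ.exists_hidden 1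
  refine wp_rejected_le_half (P := fun r => IsSharing r 0) ENNReal.zero_ne_top
    (ensures_genRand (deg N)) ((rel_genRand hQ.pos hQ.few hΛ).mono ?_) ?_ view
  · rintro v w ⟨rfl, _⟩ hv hw
    simpa using hQ.unique hw (PolyShares.add hv hΛ.1)
  · rintro r ⟨s, hr⟩ hr0
    refine (ensures_bitFrom hQ hr).weaken ?_
    rintro _ (⟨rfl, _⟩ | ⟨_, rfl⟩)
    · exact absurd hr hr0
    · simp

/-- All sharings of bits with the same dishonest shares are equally likely. -/
theorem exec_bitAttempt_le (hQ : IsQuorum A) {v v' : Shares p N} {b b' : Bool} (hv : IsBit v b)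
    (hv' : IsBit v' b') (hs : SameHeld A v v') (view w : List (Event p N)) :
    (genRand A (deg N) >>= bitFrom A).exec view (some (some v), w) ≤
      (genRand A (deg N) >>= bitFrom A).exec view (some (some v'), w) := by
  classical
  have h2 := hQ.two_ne_zero
  -- The output `v = (r / t + 1) / 2` is inverted by `r = t (2 v - 1)`, where `t` is the root of the
  -- opened square. The transport keeps `t` and replaces `v` by `v'`; this map needs `t` as a
  -- function of `r`.
  let root : Shares p N → ZMod p := fun r =>
    if h : ∃ s, IsSharing r s then smallRoot (h.choose * h.choose) else 0
  have hroot : ∀ r s, IsSharing r s → root r = smallRoot (s * s) := by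
    intro r s hr
    have h : ∃ s, IsSharing r s := ⟨s, hr⟩
    simp only [root, dif_pos h, hQ.unique h.choose_spec hr]
  have hsign : ∀ {x : Shares p N} {c : Bool} (t : ZMod p), IsBit x c →
      IsSharing (t • ((2 : ZMod p) • x - const 1)) (t * (2 * (c.toNat : ZMod p) - 1)) :=
    fun t hx => ((PolyShares.smul 2 hx).sub (polyShares_const _ 1)).smul t
  have hsq : ∀ c : Bool, (2 * (c.toNat : ZMod p) - 1) ^ 2 = 1 := by
    intro c; cases c <;> norm_num
  -- The random vectors for which the attempt is accepted with output `v`.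
  let S : Set (Shares p N) := {r | ∃ s, IsSharing r s ∧ s ≠ 0 ∧
    r = smallRoot (s * s) • ((2 : ZMod p) • v - const 1)}
  rw [exec_bind_apply_some, exec_bind_apply_some]
  refine wp_le_of_injOn _ view S (fun r => root r • ((2 : ZMod p) • v' - const 1))
    ?_ ?_ ?_ ?_ ?_
  · rintro r₁ ⟨s₁, hr₁, _, h₁⟩ r₂ ⟨s₂, hr₂, _, h₂⟩ h
    dsimp only at h
    rw [hroot _ _ hr₁, hroot _ _ hr₂] at h
    have h3 := hQ.unique (hsign (smallRoot (s₁ * s₁)) hv') (h ▸ hsign (smallRoot (s₂ * s₂)) hv')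
    have h4 : (2 * (b'.toNat : ZMod p) - 1) ≠ 0 := fun h0 => by
      have := hsq b'
      rw [h0] at this
      simp at this
    rw [h₁, h₂, mul_right_cancel₀ h4 h3]
  · rintro r ⟨s, hr, hs0, h⟩ u
    rw [hroot _ _ hr]
    -- The old and the new random vector differ by `2 t (v' - v)`, which is invisible to the
    -- adversary.
    have hΔ := ((hidden_sub hv' hv hs.symm).smul (2 * smallRoot (s * s)))
    refine (rel_genRand hQ.pos hQ.few hΔ).exec_le ?_ view u
    rintro x y ⟨rfl, _⟩ rfl
    conv_lhs => rw [h]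
    module
  · intro u; exact le_rfl
  · rintro r ⟨s, hr, hs0, h⟩ u
    dsimp only
    rw [hroot _ _ hr]
    set t := smallRoot (s * s) with ht
    have ht0 : t ≠ 0 := smallRoot_ne_zero hs0
    have htt : t ^ 2 = s * s := smallRoot_sq s
    have hr' := hsign t hv'
    -- Since `2 b' - 1` is a sign, the square is unchanged. The shift of the product can therefore
    -- be taken to be `0`, and the opened vectors are equal.
    have hss : (t * (2 * (b'.toNat : ZMod p) - 1)) * (t * (2 * (b'.toNat : ZMod p) - 1)) = s * s := by
      linear_combination t ^ 2 * hsq b' + htt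
    have hheld : SameHeld A r (t • ((2 : ZMod p) • v' - const 1)) := by
      rw [h]
      exact ((hs.smul 2).sub (SameHeld.refl _)).smul t
    have hrel : Rel (fun _ o => o = some v') (bitFrom A r)
        (bitFrom A (t • ((2 : ZMod p) • v' - const 1))) := by
      refine (rel_multiply (Δ := 0) hQ.lt hQ.pos hQ.few hr hr hr' hr' hheld hheld
        (hidden_zero.congr (by rw [hss, sub_self]))).bind fun q q' ⟨hq, hq1, _⟩ => ?_
      rw [hq, add_zero]
      refine (rel_reconst hQ.lt hQ.pos hQ.few hq1).bind fun a a' ⟨ha, ha'⟩ => ?_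
      have ha0 : s * s ≠ 0 := mul_ne_zero hs0 hs0
      rw [ha, ha', if_neg ha0, if_neg ha0]
      refine Rel.pure (congrArg some ?_)
      rw [← ht, smul_smul t⁻¹, inv_mul_cancel₀ ht0, one_smul, sub_add_cancel, smul_smul,
        inv_mul_cancel₀ h2, one_smul]
    exact hrel.exec_le (fun x y h _ => h) u w
  · intro r hr u
    dsimp only
    by_cases hex : ∃ s, IsSharing r s
    · obtain ⟨s, hrs⟩ := hex
      rw [(ensures_bitFrom hQ hrs).exec_eq_zero ENNReal.zero_ne_top, mul_zero]
      rintro (⟨_, h⟩ | ⟨hs0, h⟩)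
      · simp at h
      · refine hr ⟨s, hrs, hs0, ?_⟩
        have ht0 := smallRoot_ne_zero hs0
        cases h
        rw [smul_smul, mul_inv_cancel₀ h2, one_smul, add_sub_cancel_right, smul_smul,
          mul_inv_cancel₀ ht0, one_smul]
    · rw [(ensures_genRand _).exec_eq_zero ENNReal.zero_ne_top (fun h => hex h), zero_mul]

/-- Two vectors are sharings of bits with the same dishonest shares. -/
def BitsSameHeld (A : Adversary p N) (v v' : Shares p N) : Prop :=
  (∃ b, IsBit v b) ∧ (∃ b, IsBit v' b) ∧ SameHeld A v v'

theorem exec_randBits_le (hQ : IsQuorum A) (K : ℕ) {α : Type} (l : List α)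
    {vs vs' : List (Shares p N)} (h : List.Forall₂ (BitsSameHeld A) vs vs')
    (view w : List (Event p N)) :
    (l.mapM fun _ => randBit A K).exec view (some vs, w) ≤
      (l.mapM fun _ => randBit A K).exec view (some vs', w) :=
  exec_mapM_const_le (fun _ _ ⟨⟨_, h⟩, ⟨_, h'⟩, hs⟩ => exec_retry_le
    (fun view w => exec_bitAttempt_le hQ h h' hs view w) K) l h view w

theorem bitsSameHeld_of_areBits {vs vs' : List (Shares p N)} {bs bs' : List Bool}
    (h : AreBits vs bs) (h' : AreBits vs' bs') (hs : List.Forall₂ (SameHeld A) vs vs') :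
    List.Forall₂ (BitsSameHeld A) vs vs' := by
  induction hs generalizing bs bs' with
  | nil => exact .nil
  | cons hv _ ih =>
    rcases h with _ | ⟨hb, h⟩
    rcases h' with _ | ⟨hb', h'⟩
    exact .cons ⟨⟨_, hb⟩, ⟨_, hb'⟩, hv⟩ (ih h h')

theorem exists_areBits {vs : List (Shares p N)} (h : ∀ v ∈ vs, ∃ b, IsBit v b) :
    ∃ bs, AreBits vs bs := by
  induction vs with
  | nil => exact ⟨[], .nil⟩
  | cons v vs ih =>
    obtain ⟨b, hb⟩ := h v (by simp)
    obtain ⟨bs, hbs⟩ := ih fun w hw => h w (by simp [hw])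
    exact ⟨b :: bs, .cons hb hbs⟩

theorem ensures_randBits (hQ : IsQuorum A) (K n : ℕ) :
    Ensures (fun vs => ∃ bs, AreBits vs bs ∧ bs.length = n) (n * 2⁻¹ ^ K)
      ((List.range n).mapM fun _ => randBit A K) := by
  have h := ensures_mapM_const (ensures_randBit hQ K) (List.range n)
  rw [List.length_range] at h
  refine h.weaken fun vs ⟨hl, hvs⟩ => ?_
  obtain ⟨bs, hbs⟩ := exists_areBits hvs
  exact ⟨bs, hbs, by rw [← hbs.length_eq, hl]⟩

end RandomBit

/-! ### Random numbers shared bit by bit -/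

section RandomNumber

variable {p N : ℕ} [Fact p.Prime] {A : Adversary p N}

/-- Replace the secrets `bs` by `bs'`, using a vector `Λ` of shares of `1`. -/
def flipBits (Λ : Shares p N) : List (Shares p N) → List Bool → List Bool → List (Shares p N)
  | v :: vs, b :: bs, b' :: bs' =>
    (v + ((b'.toNat : ZMod p) - (b.toNat : ZMod p)) • Λ) :: flipBits Λ vs bs bs'
  | _, _, _ => []

/-- Add a vector to the head of a list. -/
def addHead (Δ : Shares p N) : List (Shares p N) → List (Shares p N)
  | [] => []
  | v :: vs => (v + Δ) :: vs

theorem addHead_injective (Δ : Shares p N) : Function.Injective (addHead Δ) := by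
  intro vs ws h
  rcases vs with _ | ⟨v, vs⟩ <;> rcases ws with _ | ⟨w, ws⟩ <;> simp [addHead] at h ⊢
  exact h

theorem areBits_addHead {Δ : Shares p N} (hΔ : Hidden A (deg N) Δ 0) {vs : List (Shares p N)}
    {bs : List Bool} (h : AreBits vs bs) : AreBits (addHead Δ vs) bs := by
  rcases h with _ | ⟨hv, h⟩
  · exact .nil
  · exact .cons ((PolyShares.add hv hΔ.1).congr (add_zero _)) h

theorem sameHeld_addHead {Δ : Shares p N} {a : ZMod p} (hΔ : Hidden A (deg N) Δ a)
    {vs ws : List (Shares p N)} (h : List.Forall₂ (SameHeld A) vs ws) :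
    List.Forall₂ (SameHeld A) vs (addHead Δ ws) := by
  rcases h with _ | ⟨hv, h⟩
  · exact .nil
  · exact .cons (fun i hi => by simp [hv i hi, hΔ.2 i hi]) h

theorem recompose_addHead (Δ : Shares p N) {vs : List (Shares p N)} (h : vs ≠ []) :
    recompose (addHead Δ vs) = recompose vs + Δ := by
  rcases vs with _ | ⟨v, vs⟩
  · exact absurd rfl h
  · rw [addHead, recompose_cons, recompose_cons]
    abel

theorem flipBits_spec {Λ : Shares p N} (hΛ : Hidden A (deg N) Λ 1) {vs : List (Shares p N)}
    {bs bs' : List Bool} (h : AreBits vs bs) (hl : bs.length = bs'.length) :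
    AreBits (flipBits Λ vs bs bs') bs' ∧ List.Forall₂ (SameHeld A) vs (flipBits Λ vs bs bs') ∧
      recompose (flipBits Λ vs bs bs') =
        recompose vs + ((natOfBits bs' : ZMod p) - (natOfBits bs : ZMod p)) • Λ := by
  induction h generalizing bs' with
  | nil =>
    obtain rfl := List.length_eq_zero_iff.1 hl.symm
    exact ⟨.nil, .nil, by simp [flipBits, natOfBits]⟩
  | @cons v b vs bs hv _ ih =>
    rcases bs' with _ | ⟨b', bs'⟩
    · simp at hl
    obtain ⟨h1, h2, h3⟩ := ih (bs' := bs') (by simpa using hl)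
    have hΔ := hΛ.smul ((b'.toNat : ZMod p) - (b.toNat : ZMod p))
    refine ⟨.cons ((PolyShares.add hv hΔ.1).congr (by ring)) h1, .cons (hΔ.sameHeld_add v) h2, ?_⟩
    rw [flipBits, recompose_cons, recompose_cons, h3]
    simp only [natOfBits, Nat.cast_add, Nat.cast_mul, Nat.cast_ofNat]
    module

theorem flipBits_injective (Λ : Shares p N) {vs ws : List (Shares p N)} {bs bs' : List Bool}
    (hv : vs.length = bs.length) (hw : ws.length = bs.length) (hl : bs.length = bs'.length)
    (h : flipBits Λ vs bs bs' = flipBits Λ ws bs bs') : vs = ws := by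
  induction bs generalizing vs ws bs' with
  | nil => rw [List.length_eq_zero_iff.1 hv, List.length_eq_zero_iff.1 hw]
  | cons b bs ih =>
    rcases vs with _ | ⟨v, vs⟩
    · simp at hv
    rcases ws with _ | ⟨w, ws⟩
    · simp at hw
    rcases bs' with _ | ⟨b', bs'⟩
    · simp at hl
    simp only [flipBits, List.cons.injEq, add_left_inj] at h
    rw [h.1, ih (by simpa using hv) (by simpa using hw) (by simpa using hl) h.2]

/-- `vs` consists of sharings of the `n` binary digits of a number `r`. -/
def SharesNumber (n : ℕ) (vs : List (Shares p N)) (r : ℕ) : Prop :=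
  ∃ bs, AreBits vs bs ∧ bs.length = n ∧ natOfBits bs = r

theorem IsQuorum.number_unique (hQ : IsQuorum A) {n m : ℕ} {vs : List (Shares p N)} {r s : ℕ}
    (h : SharesNumber n vs r) (h' : SharesNumber m vs s) : r = s := by
  obtain ⟨bs, hb, -, rfl⟩ := h
  obtain ⟨bs', hb', -, rfl⟩ := h'
  rw [hQ.bits_unique hb hb']

theorem SharesNumber.lt {n : ℕ} {vs : List (Shares p N)} {r : ℕ} (h : SharesNumber n vs r) :
    r < 2 ^ n := by
  obtain ⟨bs, -, rfl, rfl⟩ := h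
  exact natOfBits_lt bs

/-- If all sharings of numbers in `D` with the same dishonest shares are equally likely, then the
shared number can be changed by any injection of `D` into itself, and the recomposed sharing can be
shifted by any hidden sharing of zero. -/
theorem rel_of_exchangeable (hQ : IsQuorum A) {n : ℕ} (hn : n ≠ 0) {D : Set ℕ} {c : ENNReal}
    (hc : c ≠ ⊤) {m : Proto p N (List (Shares p N))}
    (hm : Ensures (fun vs => ∃ r ∈ D, SharesNumber n vs r) c m)
    (hex : ∀ vs vs' r r', SharesNumber n vs r → SharesNumber n vs' r' → r ∈ D → r' ∈ D →
      List.Forall₂ (SameHeld A) vs vs' → ∀ view w,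
        m.exec view (some vs, w) ≤ m.exec view (some vs', w))
    {g : ℕ → ℕ} (hg : Set.MapsTo g D D) (hg2 : ∀ r ∈ D, g r < 2 ^ n) (hinj : Set.InjOn g D)
    {Λ Δ : Shares p N} (hΛ : Hidden A (deg N) Λ 1) (hΔ : Hidden A (deg N) Δ 0) :
    Rel (fun vs ws => ∃ r ∈ D, SharesNumber n vs r ∧ SharesNumber n ws (g r) ∧
      List.Forall₂ (SameHeld A) vs ws ∧
      recompose ws = recompose vs + ((g r : ZMod p) - (r : ZMod p)) • Λ + Δ) m m := by
  classical
  let bits : List (Shares p N) → List Bool := fun vs =>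
    if h : ∃ bs, AreBits vs bs then h.choose else []
  have hbits : ∀ {vs bs}, AreBits vs bs → bits vs = bs := by
    intro vs bs h
    have hex : ∃ bs, AreBits vs bs := ⟨bs, h⟩
    simp only [bits, dif_pos hex]
    exact hQ.bits_unique hex.choose_spec h
  -- Digits are changed by multiples of `Λ`; the extra `Δ` goes to the lowest digit, which has
  -- weight `1` in `recompose`.
  let τ : List (Shares p N) → List (Shares p N) := fun vs =>
    addHead Δ (flipBits Λ vs (bits vs) (bitsOfNat n (g (natOfBits (bits vs)))))
  have hτ : ∀ vs bs, AreBits vs bs → bs.length = n → natOfBits bs ∈ D →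
      AreBits (τ vs) (bitsOfNat n (g (natOfBits bs))) ∧ List.Forall₂ (SameHeld A) vs (τ vs) ∧
      recompose (τ vs) =
        recompose vs + ((g (natOfBits bs) : ZMod p) - (natOfBits bs : ZMod p)) • Λ + Δ := by
    intro vs bs h hl hD
    obtain ⟨h1, h2, h3⟩ := flipBits_spec hΛ h (bs' := bitsOfNat n (g (natOfBits bs)))
      (by rw [hl, length_bitsOfNat])
    simp only [τ, hbits h]
    refine ⟨areBits_addHead hΔ h1, sameHeld_addHead hΔ h2, ?_⟩
    rw [recompose_addHead, h3, natOfBits_bitsOfNat (hg2 _ hD)]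
    intro h0
    have := h1.length_eq
    rw [h0, length_bitsOfNat] at this
    exact hn this.symm
  intro view F G h0 h1
  refine wp_le_of_injOn m view {vs | ∃ r ∈ D, SharesNumber n vs r} τ ?_ ?_ h0 ?_ ?_
  · rintro vs ⟨r, hr, bs, hb, hl, rfl⟩ ws ⟨s, hs, cs, hc, hl', rfl⟩ h
    have h2 := (hτ vs bs hb hl hr).1
    have h3 := (hτ ws cs hc hl' hs).1
    rw [h] at h2
    have h4 := congrArg natOfBits (hQ.bits_unique h2 h3)
    rw [natOfBits_bitsOfNat (hg2 _ hr), natOfBits_bitsOfNat (hg2 _ hs)] at h4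
    obtain rfl := natOfBits_injective (hl.trans hl'.symm) (hinj hr hs h4)
    simp only [τ, hbits hb, hbits hc] at h
    exact flipBits_injective Λ hb.length_eq hc.length_eq (by rw [hl, length_bitsOfNat])
      (addHead_injective Δ h)
  · rintro vs ⟨r, hr, bs, hb, hl, rfl⟩ w
    obtain ⟨h2, h3, -⟩ := hτ vs bs hb hl hr
    exact hex vs (τ vs) _ _ ⟨bs, hb, hl, rfl⟩ ⟨_, h2, length_bitsOfNat _ _, rfl⟩ hr
      (by rw [natOfBits_bitsOfNat (hg2 _ hr)]; exact hg hr) h3 view w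
  · rintro vs ⟨r, hr, bs, hb, hl, rfl⟩ w
    obtain ⟨h2, h3, h4⟩ := hτ vs bs hb hl hr
    exact h1 _ _ _ ⟨_, hr, ⟨bs, hb, hl, rfl⟩,
      ⟨_, h2, length_bitsOfNat _ _, natOfBits_bitsOfNat (hg2 _ hr)⟩, h3, h4⟩
  · intro vs hvs w
    rw [hm.exec_eq_zero hc hvs, zero_mul]

theorem two_le_bitLength : 2 ≤ bitLength p := by
  have : 2 ^ 1 ≤ p := (Fact.out : p.Prime).two_le
  exact Nat.lt_size.2 this

theorem lt_two_pow_bitLength : p < 2 ^ bitLength p := Nat.lt_size_self p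

theorem two_pow_le_of_bitLength : 2 ^ (bitLength p - 1) ≤ p := by
  have hp := (Fact.out : p.Prime).pos
  exact Nat.lt_size.1 (Nat.sub_lt (Nat.size_pos.2 hp) one_pos)

theorem IsQuorum.testBit_zero (hQ : IsQuorum A) : p.testBit 0 = true := by
  have := (Fact.out : p.Prime).eq_two_or_odd.resolve_left hQ.odd
  simp [this]

/-- The continuation of an attempt at a random number. -/
def numberFrom (A : Adversary p N) (bs : List (Shares p N)) :
    Proto p N (Option (List (Shares p N))) := do
  let l ← ltPublic A bs p
  let ok ← reconst A l
  if ok = 1 then pure (some bs) else pure none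

theorem randBitwise_eq (A : Adversary p N) (K : ℕ) :
    randBitwise A K = retry K
      (((List.range (bitLength p)).mapM fun _ => randBit A K) >>= numberFrom A) := rfl

theorem ensures_numberFrom (hQ : IsQuorum A) {vs : List (Shares p N)} {r : ℕ}
    (h : SharesNumber (bitLength p) vs r) :
    Ensures (fun o => o = if r < p then some vs else none) 0 (numberFrom A vs) := by
  obtain ⟨bs, hb, hl, rfl⟩ := h
  refine (ensures_ltPublic hQ hb (hl ▸ lt_two_pow_bitLength)).bind_zero fun l hlt => ?_
  refine (ensures_reconst hQ.lt hQ.pos hQ.few hlt).bind_zero fun a ha => ?_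
  by_cases h : natOfBits bs < p
  · rw [if_pos (show a = 1 by simp [ha, h])]
    exact Ensures.pure (by rw [if_pos h])
  · rw [if_neg (show a ≠ 1 by simp [ha, h])]
    exact Ensures.pure (by rw [if_neg h])

theorem ensures_randDigits (hQ : IsQuorum A) (K : ℕ) :
    Ensures (fun vs => ∃ r, SharesNumber (bitLength p) vs r) (bitLength p * 2⁻¹ ^ K)
      ((List.range (bitLength p)).mapM fun _ => randBit A K) :=
  (ensures_randBits hQ K (bitLength p)).weaken fun _ ⟨bs, h, hl⟩ => ⟨_, bs, h, hl, rfl⟩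

theorem natCast_mul_pow_ne_top (n K : ℕ) : ((n : ENNReal) * 2⁻¹ ^ K) ≠ ⊤ :=
  ENNReal.mul_ne_top (by simp) (by simp)

theorem exec_randDigits_le (hQ : IsQuorum A) (K : ℕ) {vs vs' : List (Shares p N)} {n r r' : ℕ}
    (h : SharesNumber n vs r) (h' : SharesNumber n vs' r')
    (hs : List.Forall₂ (SameHeld A) vs vs') (view w : List (Event p N)) :
    ((List.range (bitLength p)).mapM fun _ => randBit A K).exec view (some vs, w) ≤
      ((List.range (bitLength p)).mapM fun _ => randBit A K).exec view (some vs', w) := by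
  obtain ⟨bs, hb, -⟩ := h
  obtain ⟨bs', hb', -⟩ := h'
  exact exec_randBits_le hQ K _ (bitsSameHeld_of_areBits hb hb' hs) view w

theorem ensures_randBitwise (hQ : IsQuorum A) (K : ℕ) :
    Ensures (fun vs => ∃ r ∈ Set.Iio p, SharesNumber (bitLength p) vs r)
      (2⁻¹ ^ K + 2 * (bitLength p * 2⁻¹ ^ K)) (randBitwise A K) := by
  rw [randBitwise_eq]
  refine Ensures.retry ?_ ?_ K
  · refine (ensures_randDigits hQ K).bind_zero_right fun vs ⟨r, h⟩ =>
      (ensures_numberFrom hQ h).weaken ?_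
    rintro _ rfl ws hws
    split_ifs at hws with hr
    cases hws
    exact ⟨r, hr, h⟩
  · intro view
    obtain ⟨Λ, hΛ⟩ := hQ.exists_hidden 1
    have h2 := two_le_bitLength (p := p)
    have hp := two_pow_le_of_bitLength (p := p)
    -- The involution below flips the top digit, of weight `2 ^ n`. As `2 ^ n ≤ p`, a rejected
    -- number has this digit set and is carried below `2 ^ n`, where it is accepted.
    obtain ⟨n, hn⟩ : ∃ n, bitLength p = n + 1 := ⟨bitLength p - 1, by omega⟩
    rw [hn, Nat.add_sub_cancel] at hp
    have hpow : 2 ^ bitLength p = 2 * 2 ^ n := by rw [hn, pow_succ']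
    refine wp_rejected_le_half (P := fun vs => ∃ r, SharesNumber (bitLength p) vs r ∧ p ≤ r)
      (natCast_mul_pow_ne_top _ _) (ensures_randDigits hQ K)
      ((rel_of_exchangeable hQ (n := bitLength p) (by omega) (D := Set.Iio (2 ^ bitLength p))
        (natCast_mul_pow_ne_top _ _)
        ((ensures_randDigits hQ K).weaken fun vs ⟨r, h⟩ => ⟨r, h.lt, h⟩)
        (fun vs vs' r r' h h' _ _ hs view w => exec_randDigits_le hQ K h h' hs view w)
        (g := fun r => if r < 2 ^ n then r + 2 ^ n else r - 2 ^ n) ?_ ?_ ?_ hΛ hidden_zero).mono ?_)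
      ?_ view
    · intro r hr
      simp only [Set.mem_Iio, hpow] at hr ⊢
      split_ifs <;> omega
    · intro r hr
      simp only [Set.mem_Iio, hpow] at hr ⊢
      split_ifs <;> omega
    · intro r hr s hs h
      simp only [Set.mem_Iio, hpow] at hr hs h
      split_ifs at h <;> omega
    · rintro vs ws ⟨r, hr, hvs, hws, -⟩ ⟨r', hvs', hr'⟩ ⟨s, hws', hs⟩
      obtain rfl := hQ.number_unique hvs hvs'
      obtain rfl := hQ.number_unique hws hws'
      simp only [Set.mem_Iio, hpow] at hr
      have hpos : 0 < 2 ^ n := by positivity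
      have := lt_of_le_of_ne hp fun h => by
        have h1 := hQ.testBit_zero
        rw [← h, Nat.testBit_two_pow] at h1
        have : n = 0 := by simpa using h1
        omega
      split_ifs at hs <;> omega
    · rintro vs ⟨r, h⟩ hP
      refine (ensures_numberFrom hQ h).weaken ?_
      rintro _ rfl
      rw [if_pos (not_le.1 fun hr => hP ⟨r, h, hr⟩)]
      simp

/-- All sharings of numbers less than `p` with the same dishonest shares are equally likely. -/
theorem exec_randBitwise_le (hQ : IsQuorum A) (K : ℕ) {vs vs' : List (Shares p N)} {r r' : ℕ}
    (h : SharesNumber (bitLength p) vs r) (h' : SharesNumber (bitLength p) vs' r') (hr : r < p)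
    (hr' : r' < p) (hs : List.Forall₂ (SameHeld A) vs vs') (view w : List (Event p N)) :
    (randBitwise A K).exec view (some vs, w) ≤ (randBitwise A K).exec view (some vs', w) := by
  classical
  rw [randBitwise_eq]
  refine exec_retry_le (fun view w => ?_) K view w
  rw [exec_bind_apply_some, exec_bind_apply_some]
  refine wp_le_of_injOn _ view {vs} (fun _ => vs') (Set.injOn_singleton _ _) ?_ ?_ ?_ ?_
  · rintro _ rfl u
    exact exec_randDigits_le hQ K h h' hs view u
  · intro u; exact le_rfl
  · intro x hx u
    rw [Set.mem_singleton_iff] at hx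
    subst x
    obtain ⟨bs, hb, hl, rfl⟩ := h
    obtain ⟨bs', hb', hl', rfl⟩ := h'
    -- Both numbers are below `p`, so the test bits agree and `rel_ltPublic` makes even their opened
    -- sharings equal.
    have hrel : Rel (fun _ o => o = some vs') (numberFrom A vs) (numberFrom A vs') := by
      refine (((rel_ltPublic hQ hb hb' hs (hl ▸ lt_two_pow_bitLength) hQ.testBit_zero
        (hl ▸ two_le_bitLength) (iff_of_true hr hr')).and_ensures
        (ensures_ltPublic hQ hb (hl ▸ lt_two_pow_bitLength)) ENNReal.zero_ne_top
        (ensures_ltPublic hQ hb' (hl' ▸ lt_two_pow_bitLength)) ENNReal.zero_ne_top)).bind ?_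
      rintro l _ ⟨rfl, hlt, -⟩
      refine (rel_reconst hQ.lt hQ.pos hQ.few hlt).bind fun a a' ⟨ha, ha'⟩ => ?_
      rw [if_pos (by simp [ha, hr]), if_pos (by simp [ha', hr])]
      exact Rel.pure rfl
    exact hrel.exec_le (fun x y h _ => h) u w
  · intro x hx u
    dsimp only
    have hrel : Rel (fun o _ => o ≠ some vs) (numberFrom A x) (numberFrom A x) := by
      refine (Rel.refl (ltPublic A x p)).bind fun l l' hll => ?_
      subst hll
      refine (Rel.refl (reconst A l)).bind fun a a' haa => ?_
      subst haa
      split_ifs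
      · exact Rel.pure fun h => hx (Option.some.inj h)
      · exact Rel.pure (by simp)
    rw [hrel.exec_eq_zero fun _ _ h => h, mul_zero]

/-- The random number can be used to mask two different values. -/
theorem rel_randBitwise (hQ : IsQuorum A) (K : ℕ) {x x' : Shares p N} {s s' : ZMod p}
    (hx : IsSharing x s) (hx' : IsSharing x' s') (hs : SameHeld A x x') :
    Rel (fun vs ws => x + recompose vs = x' + recompose ws ∧ List.Forall₂ (SameHeld A) vs ws ∧
      ∃ bs bs', AreBits vs bs ∧ AreBits ws bs' ∧ bs.length = bitLength p ∧
        bs'.length = bitLength p ∧ natOfBits bs < p ∧ natOfBits bs' < p)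
      (randBitwise A K) (randBitwise A K) := by
  have h2 := two_le_bitLength (p := p)
  obtain ⟨Λ, hΛ⟩ := hQ.exists_hidden 1
  -- The substitution `r ↦ r + (s - s')` modulo `p` shifts the recomposed vector by `(s - s') • Λ`.
  -- This hidden zero sharing corrects the shift to exactly `x - x'`.
  have hΔ : Hidden A (deg N) ((x - x') - (s - s') • Λ) 0 :=
    ((hidden_sub hx hx' hs).sub (hΛ.smul (s - s'))).congr (by ring)
  have hval : ∀ r : ℕ, ((r : ZMod p) + (s - s')).val < p := fun r => ZMod.val_lt _
  refine (rel_of_exchangeable hQ (n := bitLength p) (by omega) (D := Set.Iio p) ?_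
    (ensures_randBitwise hQ K)
    (fun vs vs' r r' h h' hr hr' hs view w => exec_randBitwise_le hQ K h h' hr hr' hs view w)
    (g := fun r => ((r : ZMod p) + (s - s')).val) (fun r _ => hval r)
    (fun r _ => (hval r).trans lt_two_pow_bitLength) ?_ hΛ hΔ).mono ?_
  · exact ENNReal.add_ne_top.2 ⟨by simp, ENNReal.mul_ne_top (by simp) (natCast_mul_pow_ne_top _ _)⟩
  · intro r hr t ht h
    have h3 := add_right_cancel (ZMod.val_injective p h)
    rwa [ZMod.natCast_eq_natCast_iff', Nat.mod_eq_of_lt hr, Nat.mod_eq_of_lt ht] at h3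
  · rintro vs ws ⟨r, hr, ⟨bs, hb, hl, rfl⟩, ⟨bs', hb', hl', hr'⟩, hsame, hrec⟩
    refine ⟨?_, hsame, bs, bs', hb, hb', hl, hl', hr, hr' ▸ hval _⟩
    rw [hrec, ZMod.natCast_zmod_val]
    module

end RandomNumber

/-! ### Comparison of shared values -/

section SharedComparison

variable {p N : ℕ} [Fact p.Prime] {A : Adversary p N}

theorem testBit_zero_natOfBits (b : Bool) (bs : List Bool) :
    (natOfBits (b :: bs)).testBit 0 = b := by
  rw [natOfBits, Nat.testBit_zero]
  cases b <;> simp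

/-- The least significant bit of `t`, from the reduction of `t + r` modulo an odd number. -/
theorem leastBit_eq (hp : p.testBit 0 = true) {t : ZMod p} {r : ℕ} (hr : r < p) :
    (decide ((t + (r : ZMod p)).val < r) ^^ (r.testBit 0 ^^ (t + (r : ZMod p)).val.testBit 0)) =
      t.val.testBit 0 := by
  have ht := ZMod.val_lt t
  have hodd : p % 2 = 1 := by simpa using hp
  rw [ZMod.val_add, ZMod.val_natCast, Nat.mod_eq_of_lt hr]
  simp only [Nat.testBit_zero]
  by_cases h : t.val + r < p
  · rw [Nat.mod_eq_of_lt h, decide_eq_false (by omega : ¬ t.val + r < r)]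
    rcases Nat.mod_two_eq_zero_or_one t.val with h1 | h1 <;>
      rcases Nat.mod_two_eq_zero_or_one r with h2 | h2 <;> simp [h1, h2, Nat.add_mod]
  -- On overflow the public sum is smaller than `r`, and subtracting the odd number `p` flips the
  -- parity.
  · have e : (t.val + r) % p = t.val + r - p := by
      rw [Nat.mod_eq_sub_mod (by omega), Nat.mod_eq_of_lt (by omega)]
    rw [e, decide_eq_true (by omega : t.val + r - p < r)]
    have e2 : (t.val + r - p) % 2 = (t.val + r + 1) % 2 := by omega
    rcases Nat.mod_two_eq_zero_or_one t.val with h1 | h1 <;>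
      rcases Nat.mod_two_eq_zero_or_one r with h2 | h2 <;>
        simp [e2, h1, h2, Nat.add_mod]

/-- A bound for the failure probability of `leastBit`. -/
def failBound (p K : ℕ) : ENNReal := 2⁻¹ ^ K + 2 * (bitLength p * 2⁻¹ ^ K)

theorem failBound_ne_top (p K : ℕ) : failBound p K ≠ ⊤ :=
  ENNReal.add_ne_top.2 ⟨by simp, ENNReal.mul_ne_top (by simp) (natCast_mul_pow_ne_top _ _)⟩

/-- The end of `leastBit`. -/
def leastBitFrom (A : Adversary p N) (bs : List (Shares p N)) (c : ZMod p) :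
    Proto p N (Shares p N) := do
  let wrap ← publicLt A c.val bs
  let g := xorPublic (bs.headD (const 0)) (c.val.testBit 0)
  let wg ← multiply A wrap g
  pure (wrap + g - (2 : ZMod p) • wg)

theorem leastBit_eq_bind (A : Adversary p N) (K : ℕ) (x : Shares p N) :
    leastBit A K x = randBitwise A K >>= fun bs =>
      reconst A (x + recompose bs) >>= fun c => leastBitFrom A bs c := rfl

theorem isBit_headD {vs : List (Shares p N)} {bs : List Bool} (h : AreBits vs bs)
    (hl : bs.length ≠ 0) : IsBit (vs.headD (const 0)) ((natOfBits bs).testBit 0) := by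
  rcases h with _ | ⟨hv, h⟩
  · simp at hl
  · rw [testBit_zero_natOfBits]
    exact hv

theorem sameHeld_headD {vs ws : List (Shares p N)} (h : List.Forall₂ (SameHeld A) vs ws) :
    SameHeld A (vs.headD (const 0)) (ws.headD (const 0)) := by
  rcases h with _ | ⟨hv, h⟩
  · exact SameHeld.refl _
  · exact hv

theorem zmod_val_lt_two_pow (c : ZMod p) {n : ℕ} (hn : n = bitLength p) : c.val < 2 ^ n :=
  hn ▸ (ZMod.val_lt c).trans lt_two_pow_bitLength

theorem bitLength_ne_zero : bitLength p ≠ 0 := by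
  have := two_le_bitLength (p := p)
  omega

theorem ensures_leastBitFrom (hQ : IsQuorum A) {vs : List (Shares p N)} {bs : List Bool}
    (h : AreBits vs bs) (hl : bs.length = bitLength p) (hr : natOfBits bs < p) (t : ZMod p) :
    Ensures (fun v => IsBit v (t.val.testBit 0)) 0
      (leastBitFrom A vs (t + (natOfBits bs : ZMod p))) := by
  refine (ensures_publicLt hQ h (zmod_val_lt_two_pow _ hl)).bind_zero fun w hw => ?_
  have hg := isBit_xorPublic (isBit_headD h (hl ▸ bitLength_ne_zero))
    ((t + (natOfBits bs : ZMod p)).val.testBit 0)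
  refine (ensures_multiply_bits hQ hw hg).bind_zero fun m hm => Ensures.pure ?_
  have h1 := isBit_xor hw hg hm
  rwa [leastBit_eq hQ.testBit_zero hr] at h1

theorem rel_leastBitFrom (hQ : IsQuorum A) {vs ws : List (Shares p N)} {bs bs' : List Bool}
    (h : AreBits vs bs) (h' : AreBits ws bs') (hs : List.Forall₂ (SameHeld A) vs ws)
    (hl : bs.length = bitLength p) (hl' : bs'.length = bitLength p) (c : ZMod p) :
    Rel (SameHeld A) (leastBitFrom A vs c) (leastBitFrom A ws c) := by
  refine (rel_publicLt hQ h h' hs (zmod_val_lt_two_pow _ hl)).bind fun w w' ⟨hw, hw1, hw2⟩ => ?_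
  have hg := isBit_xorPublic (isBit_headD h (hl ▸ bitLength_ne_zero)) (c.val.testBit 0)
  have hg' := isBit_xorPublic (isBit_headD h' (hl' ▸ bitLength_ne_zero)) (c.val.testBit 0)
  have hgg := sameHeld_xorPublic (sameHeld_headD hs) (c.val.testBit 0)
  exact (rel_multiply_sameHeld hQ.lt hQ.pos hQ.few hw1 hg hw2 hg' hw hgg).bind
    fun m m' hm => Rel.pure ((hw.add hgg).sub (hm.1.smul 2))

theorem ensures_leastBit (hQ : IsQuorum A) (K : ℕ) {x : Shares p N} {t : ZMod p}
    (hx : IsSharing x t) :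
    Ensures (fun v => IsBit v (t.val.testBit 0)) (failBound p K) (leastBit A K x) := by
  rw [leastBit_eq_bind]
  refine (ensures_randBitwise hQ K).bind_zero_right fun vs ⟨r, hr, bs, hb, hl, hbr⟩ => ?_
  subst hbr
  refine (ensures_reconst hQ.lt hQ.pos hQ.few
    (PolyShares.add hx (isSharing_recompose hb))).bind_zero fun c hc => ?_
  rw [hc]
  exact ensures_leastBitFrom hQ hb hl hr t

theorem rel_leastBit (hQ : IsQuorum A) (K : ℕ) {x x' : Shares p N} {t t' : ZMod p}
    (hx : IsSharing x t) (hx' : IsSharing x' t') (hs : SameHeld A x x') :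
    Rel (SameHeld A) (leastBit A K x) (leastBit A K x') := by
  rw [leastBit_eq_bind, leastBit_eq_bind]
  refine (rel_randBitwise hQ K hx hx' hs).bind
    fun vs ws ⟨he, hvs, bs, bs', hb, hb', hl, hl', _, _⟩ => ?_
  rw [← he]
  refine (rel_reconst hQ.lt hQ.pos hQ.few
    (PolyShares.add hx (isSharing_recompose hb))).bind fun c c' ⟨hc, hc'⟩ => ?_
  rw [hc, hc']
  exact rel_leastBitFrom hQ hb hb' hvs hl hl' _

/-- Doubling gives an even number; reduction subtracts the odd `p`, and so makes it odd, exactly if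
`t` lies in the upper half. -/
theorem testBit_zero_two_mul (hp : p.testBit 0 = true) (t : ZMod p) :
    (!(2 * t).val.testBit 0) = decide (2 * t.val < p) := by
  have ht := ZMod.val_lt t
  have hodd : p % 2 = 1 := by simpa using hp
  rw [two_mul, ZMod.val_add, ← two_mul, Nat.testBit_zero]
  by_cases h : 2 * t.val < p
  · rw [Nat.mod_eq_of_lt h]
    simp [h]
  · have e : 2 * t.val % p = 2 * t.val - p := by
      rw [Nat.mod_eq_sub_mod (by omega), Nat.mod_eq_of_lt (by omega)]
    have h1 : (2 * t.val - p) % 2 = 1 := by omega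
    simp [h, e, h1]

theorem ensures_lowerHalf (hQ : IsQuorum A) (K : ℕ) {x : Shares p N} {t : ZMod p}
    (hx : IsSharing x t) :
    Ensures (fun v => IsBit v (decide (2 * t.val < p))) (failBound p K) (lowerHalf A K x) :=
  (ensures_leastBit hQ K (PolyShares.smul 2 hx)).bind_zero_right fun v hv => Ensures.pure (by
    rw [← testBit_zero_two_mul hQ.testBit_zero]
    exact isBit_one_sub hv)

theorem rel_lowerHalf (hQ : IsQuorum A) (K : ℕ) {x x' : Shares p N} {t t' : ZMod p}
    (hx : IsSharing x t) (hx' : IsSharing x' t') (hs : SameHeld A x x') :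
    Rel (fun v w => SameHeld A v w ∧ IsBit v (decide (2 * t.val < p)) ∧
      IsBit w (decide (2 * t'.val < p))) (lowerHalf A K x) (lowerHalf A K x') :=
  Rel.and_ensures ((rel_leastBit hQ K (PolyShares.smul 2 hx) (PolyShares.smul 2 hx')
    (hs.smul 2)).bind fun _ _ hv => Rel.pure ((SameHeld.refl _).sub hv))
    (ensures_lowerHalf hQ K hx) (failBound_ne_top _ _) (ensures_lowerHalf hQ K hx')
    (failBound_ne_top _ _)

/-- The formula of Nishide and Ohta. -/
theorem lessThan_formula (s t : ZMod p) {w x y : ℕ}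
    (hw : w = (decide (2 * s.val < p)).toNat) (hx : x = (decide (2 * t.val < p)).toNat)
    (hy : y = (decide (2 * (s - t).val < p)).toNat) :
    (w : ZMod p) * (x + y - 2 * (x * y)) + 1 - y - x + x * y =
      ((decide (s.val < t.val)).toNat : ZMod p) := by
  have hs := ZMod.val_lt s
  have ht := ZMod.val_lt t
  have hst : (t.val ≤ s.val ∧ (s - t).val = s.val - t.val) ∨
      (s.val < t.val ∧ (s - t).val = p + s.val - t.val) := by
    rcases le_or_gt t.val s.val with h | h
    · exact Or.inl ⟨h, ZMod.val_sub h⟩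
    · refine Or.inr ⟨h, ?_⟩
      have h1 : t - s ≠ 0 := fun h0 => by
        rw [sub_eq_zero.1 h0] at h
        exact lt_irrefl _ h
      have : NeZero (t - s) := ⟨h1⟩
      rw [← neg_sub, ZMod.val_neg_of_ne_zero, ZMod.val_sub h.le]
      omega
  have hodd : p ≠ 0 := (Fact.out : p.Prime).ne_zero
  subst hw hx hy
  -- If `s` and `t` lie in different halves, their halves decide; otherwise `s - t` lies in the
  -- upper half exactly if it wraps around. Combinations of cases that violate this are
  -- contradictory, the others are arithmetic identities.
  by_cases h1 : 2 * s.val < p <;> by_cases h2 : 2 * t.val < p <;>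
    by_cases h3 : 2 * (s - t).val < p <;> by_cases h4 : s.val < t.val <;>
    simp only [h1, h2, h3, h4, decide_true, decide_false, Bool.toNat_true, Bool.toNat_false,
      Nat.cast_one, Nat.cast_zero] <;> first | omega | ring1

theorem isBit_lessThan {x y m n : Shares p N} {s t : ZMod p} {bw bx bb : Bool}
    (hbw : bw = decide (2 * s.val < p)) (hbx : bx = decide (2 * t.val < p))
    (hby : bb = decide (2 * (s - t).val < p)) (hx : IsBit x bx)
    (hy : IsBit y bb) (hm : IsSharing m ((bx.toNat : ZMod p) * (bb.toNat : ZMod p)))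
    (hn : IsSharing n ((bw.toNat : ZMod p) * ((bx.toNat : ZMod p) + (bb.toNat : ZMod p) -
      2 * ((bx.toNat : ZMod p) * (bb.toNat : ZMod p))))) :
    IsBit (n + const 1 - y - x + m) (decide (s.val < t.val)) := by
  refine PolyShares.congr (((((PolyShares.add hn (polyShares_const _ 1)).sub hy).sub hx).add hm)) ?_
  exact lessThan_formula s t (by rw [hbw]) (by rw [hbx]) (by rw [hby])

theorem ensures_lessThan (hQ : IsQuorum A) (K : ℕ) {v w : Shares p N} {s t : ZMod p}
    (hv : IsSharing v s) (hw : IsSharing w t) :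
    Ensures (fun x => IsBit x (decide (s.val < t.val))) (3 * failBound p K) (lessThan A K v w) := by
  have e : 3 * failBound p K = failBound p K + (failBound p K + failBound p K) := by ring
  rw [e]
  refine (ensures_lowerHalf hQ K hv).bind fun b₁ h₁ => ?_
  refine (ensures_lowerHalf hQ K hw).bind fun b₂ h₂ => ?_
  refine (ensures_lowerHalf hQ K (PolyShares.sub hv hw)).bind_zero_right fun b₃ h₃ => ?_
  refine (ensures_multiply hQ.lt hQ.pos hQ.few h₂ h₃).bind_zero fun m hm => ?_
  refine (ensures_multiply hQ.lt hQ.pos hQ.few h₁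
    ((PolyShares.add h₂ h₃).sub (PolyShares.smul 2 hm))).bind_zero fun n hn => Ensures.pure ?_
  exact isBit_lessThan rfl rfl rfl h₂ h₃ hm hn

theorem rel_lessThan (hQ : IsQuorum A) (K : ℕ) {v w v' w' : Shares p N} {s t s' t' : ZMod p}
    (hv : IsSharing v s) (hw : IsSharing w t) (hv' : IsSharing v' s') (hw' : IsSharing w' t')
    (hvv : SameHeld A v v') (hww : SameHeld A w w') :
    Rel (SameHeld A) (lessThan A K v w) (lessThan A K v' w') := by
  refine (rel_lowerHalf hQ K hv hv' hvv).bind fun b₁ b₁' ⟨h₁, h₁a, h₁b⟩ => ?_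
  refine (rel_lowerHalf hQ K hw hw' hww).bind fun b₂ b₂' ⟨h₂, h₂a, h₂b⟩ => ?_
  refine (rel_lowerHalf hQ K (PolyShares.sub hv hw) (PolyShares.sub hv' hw') (hvv.sub hww)).bind
    fun b₃ b₃' ⟨h₃, h₃a, h₃b⟩ => ?_
  refine (rel_multiply_sameHeld hQ.lt hQ.pos hQ.few h₂a h₃a h₂b h₃b h₂ h₃).bind
    fun m m' ⟨hm, hma, hmb⟩ => ?_
  refine (rel_multiply_sameHeld hQ.lt hQ.pos hQ.few h₁a
    ((PolyShares.add h₂a h₃a).sub (PolyShares.smul 2 hma)) h₁b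
    ((PolyShares.add h₂b h₃b).sub (PolyShares.smul 2 hmb)) h₁ ((h₂.add h₃).sub (hm.smul 2))).bind
    fun n n' ⟨hn, _, _⟩ => Rel.pure ?_
  exact (((hn.add (SameHeld.refl _)).sub h₃).sub h₂).add hm

theorem ensures_compare (hQ : IsQuorum A) (K : ℕ) {v w : Shares p N} {s t : ZMod p}
    (hv : IsSharing v s) (hw : IsSharing w t) :
    Ensures (fun x => IsBit x (decide (s.val ≤ t.val))) (3 * failBound p K)
      (ObliviousGate.compare A K v w) :=
  (ensures_lessThan hQ K hw hv).bind_zero_right fun x hx => Ensures.pure (by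
    have := isBit_one_sub hx
    rwa [← decide_not, decide_eq_decide.2 not_lt] at this)

theorem rel_compare (hQ : IsQuorum A) (K : ℕ) {v w v' w' : Shares p N} {s t s' t' : ZMod p}
    (hv : IsSharing v s) (hw : IsSharing w t) (hv' : IsSharing v' s') (hw' : IsSharing w' t')
    (hvv : SameHeld A v v') (hww : SameHeld A w w') :
    Rel (fun x x' => SameHeld A x x' ∧ IsBit x (decide (s.val ≤ t.val)) ∧
      IsBit x' (decide (s'.val ≤ t'.val))) (ObliviousGate.compare A K v w)
      (ObliviousGate.compare A K v' w') :=
  Rel.and_ensures ((rel_lessThan hQ K hw hv hw' hv' hww hvv).bind fun _ _ hx =>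
    Rel.pure ((SameHeld.refl _).sub hx)) (ensures_compare hQ K hv hw)
    (ENNReal.mul_ne_top (by simp) (failBound_ne_top _ _)) (ensures_compare hQ K hv' hw')
    (ENNReal.mul_ne_top (by simp) (failBound_ne_top _ _))

end SharedComparison

/-! ### The gate -/

section GateAnalysis

variable {p N : ℕ} [Fact p.Prime] {A : Adversary p N}

/-- The shared choice between `a` and `b` by a shared bit. -/
def select (A : Adversary p N) (ρ a b : Shares p N) : Proto p N (Shares p N) := do
  let m₁ ← multiply A ρ a
  let m₂ ← multiply A (const 1 - ρ) b
  pure (m₁ + m₂)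

theorem gate_eq_bind (A : Adversary p N) (K : ℕ) (V : TwoPairs (Shares p N)) :
    gate A K V = ObliviousGate.compare A K V.key₁ V.key₂ >>= fun ρ =>
      select A ρ V.key₁ V.key₂ >>= fun s => select A ρ V.msg₁ V.msg₂ >>= fun y =>
      select A ρ V.key₂ V.key₁ >>= fun s' => select A ρ V.msg₂ V.msg₁ >>= fun y' =>
      pure ⟨s, y, s', y'⟩ := rfl

theorem ensures_select (hQ : IsQuorum A) {ρ a b : Shares p N} {β : Bool} {s t : ZMod p}
    (hρ : IsBit ρ β) (ha : IsSharing a s) (hb : IsSharing b t) :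
    Ensures (fun x => IsSharing x (if β then s else t)) 0 (select A ρ a b) := by
  refine (ensures_multiply hQ.lt hQ.pos hQ.few hρ ha).bind_zero fun m hm => ?_
  refine (ensures_multiply hQ.lt hQ.pos hQ.few (isBit_one_sub hρ) hb).bind_zero
    fun n hn => Ensures.pure ((PolyShares.add hm hn).congr ?_)
  cases β <;> simp

theorem rel_select (hQ : IsQuorum A) {ρ a b ρ' a' b' : Shares p N} {β β' : Bool}
    {s t s' t' : ZMod p} (hρ : IsBit ρ β) (ha : IsSharing a s) (hb : IsSharing b t)
    (hρ' : IsBit ρ' β') (ha' : IsSharing a' s') (hb' : IsSharing b' t') (hρρ : SameHeld A ρ ρ')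
    (haa : SameHeld A a a') (hbb : SameHeld A b b') :
    Rel (SameHeld A) (select A ρ a b) (select A ρ' a' b') := by
  refine (rel_multiply_sameHeld hQ.lt hQ.pos hQ.few hρ ha hρ' ha' hρρ haa).bind
    fun m m' ⟨hm, _⟩ => ?_
  exact (rel_multiply_sameHeld hQ.lt hQ.pos hQ.few (isBit_one_sub hρ) hb
    (isBit_one_sub hρ') hb' ((SameHeld.refl _).sub hρρ) hbb).bind
    fun n n' ⟨hn, _⟩ => Rel.pure (hm.add hn)

theorem ensures_gate (hQ : IsQuorum A) (K : ℕ) {q : TwoPairs (ZMod p)}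
    {V : TwoPairs (Shares p N)} (hV : AreSharings V q) :
    Ensures (fun out => (q.key₁.val ≤ q.key₂.val → AreSharings out q) ∧
      (¬ q.key₁.val ≤ q.key₂.val → AreSharings out q.swap)) (3 * failBound p K) (gate A K V) := by
  obtain ⟨h1, h2, h3, h4⟩ := hV
  rw [gate_eq_bind]
  refine (ensures_compare hQ K h1 h3).bind_zero_right fun ρ hρ => ?_
  refine (ensures_select hQ hρ h1 h3).bind_zero fun s hs => ?_
  refine (ensures_select hQ hρ h2 h4).bind_zero fun y hy => ?_
  refine (ensures_select hQ hρ h3 h1).bind_zero fun s' hs' => ?_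
  refine (ensures_select hQ hρ h4 h2).bind_zero fun y' hy' => Ensures.pure ⟨fun h => ?_, fun h => ?_⟩
  · simp only [h, decide_true, if_true] at hs hy hs' hy'
    exact ⟨hs, hy, hs', hy'⟩
  · simp only [h, decide_false, Bool.false_eq_true, if_false] at hs hy hs' hy'
    exact ⟨hs, hy, hs', hy'⟩

theorem rel_gate (hQ : IsQuorum A) (K : ℕ) {q q' : TwoPairs (ZMod p)}
    {V V' : TwoPairs (Shares p N)} (hV : AreSharings V q) (hV' : AreSharings V' q')
    (hs : V.map A.seeHeld = V'.map A.seeHeld) :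
    Rel (fun W W' => W.map A.seeHeld = W'.map A.seeHeld) (gate A K V) (gate A K V') := by
  obtain ⟨h1, h2, h3, h4⟩ := hV
  obtain ⟨h1', h2', h3', h4'⟩ := hV'
  simp only [TwoPairs.map, TwoPairs.mk.injEq, ← sameHeld_iff] at hs
  obtain ⟨e1, e2, e3, e4⟩ := hs
  rw [gate_eq_bind, gate_eq_bind]
  refine (rel_compare hQ K h1 h3 h1' h3' e1 e3).bind fun ρ ρ' ⟨hρ, hρa, hρb⟩ => ?_
  refine (rel_select hQ hρa h1 h3 hρb h1' h3' hρ e1 e3).bind fun s s₁ hs => ?_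
  refine (rel_select hQ hρa h2 h4 hρb h2' h4' hρ e2 e4).bind fun y y₁ hy => ?_
  refine (rel_select hQ hρa h3 h1 hρb h3' h1' hρ e3 e1).bind fun s' s₁' hs' => ?_
  refine (rel_select hQ hρa h4 h2 hρb h4' h2' hρ e4 e2).bind fun y' y₁' hy' => Rel.pure ?_
  simp only [TwoPairs.map, TwoPairs.mk.injEq, ← sameHeld_iff]
  exact ⟨hs, hy, hs', hy'⟩

theorem Ensures.fail_le {α : Type} {P : α → Prop} {c : ENNReal} {m : Proto p N α}
    (h : Ensures P c m) (view : List (Event p N)) : ((m.exec view).map Prod.fst) none ≤ c := by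
  classical
  rw [← expect_single ((m.exec view).map Prod.fst), expect_map]
  refine le_trans (expect_mono _ fun z => ?_) (h view)
  rcases z with ⟨_ | a, v⟩ <;> simp [badness]

theorem exists_failBound_le (p : ℕ) {η : ENNReal} (hη : 0 < η) :
    ∃ K₀, ∀ K, K₀ ≤ K → 3 * failBound p K ≤ η := by
  have h : Filter.Tendsto (fun K : ℕ => (3 * (1 + 2 * (bitLength p : ENNReal))) * 2⁻¹ ^ K)
      Filter.atTop (nhds ((3 * (1 + 2 * (bitLength p : ENNReal))) * 0)) := by
    refine ENNReal.Tendsto.const_mul (ENNReal.tendsto_pow_atTop_nhds_zero_of_lt_one ?_) (Or.inr ?_)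
    · exact ENNReal.inv_lt_one.2 (by norm_num)
    · exact ENNReal.mul_ne_top (by simp)
        (ENNReal.add_ne_top.2 ⟨by simp, ENNReal.mul_ne_top (by simp) (by simp)⟩)
  rw [mul_zero] at h
  obtain ⟨K₀, hK⟩ := Filter.eventually_atTop.1 (h.eventually_lt_const hη)
  refine ⟨K₀, fun K hKK => le_trans (le_of_eq ?_) (hK K hKK).le⟩
  rw [failBound]
  ring

theorem adversaryLaw_le (hQ : IsQuorum A) (K : ℕ) (view : List (Event p N))
    {q q' : TwoPairs (ZMod p)} {V V' : TwoPairs (Shares p N)} (hV : AreSharings V q)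
    (hV' : AreSharings V' q') (hs : V.map A.seeHeld = V'.map A.seeHeld) (z) :
    adversaryLaw A K view V z ≤ adversaryLaw A K view V' z := by
  classical
  rw [← expect_single (adversaryLaw A K view V), ← expect_single (adversaryLaw A K view V'),
    adversaryLaw, adversaryLaw, expect_map, expect_map]
  refine rel_gate hQ K hV hV' hs view
    (fun o v => if (o.map fun out => out.map A.seeHeld, v) = z then 1 else 0)
    (fun o v => if (o.map fun out => out.map A.seeHeld, v) = z then 1 else 0) (fun v => le_rfl)
    fun W W' v h => ?_
  simp only [Option.map_some, h]
  exact le_rfl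

theorem adversaryLaw_eq (hQ : IsQuorum A) (K : ℕ) (view : List (Event p N))
    {q q' : TwoPairs (ZMod p)} {V V' : TwoPairs (Shares p N)} (hV : AreSharings V q)
    (hV' : AreSharings V' q') (hs : V.map A.seeHeld = V'.map A.seeHeld) :
    adversaryLaw A K view V = adversaryLaw A K view V' :=
  PMF.ext fun z => le_antisymm (adversaryLaw_le hQ K view hV hV' hs z)
    (adversaryLaw_le hQ K view hV' hV hs.symm z)

/-- Random sharings of different secrets can be coupled such that the dishonest shares agree. -/
theorem expect_shareRandomly_le (hQ : IsQuorum A) (a a' : ZMod p)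
    {F G : Shares p N → ENNReal}
    (h : ∀ v v', IsSharing v a → IsSharing v' a' → SameHeld A v v' → F v ≤ G v') :
    expect (shareRandomly N a) F ≤ expect (shareRandomly N a') G := by
  obtain ⟨Δ, hΔ⟩ := hQ.exists_hidden (a' - a)
  obtain ⟨f, hf, rfl⟩ := hΔ.1.exists_coeff
  -- Only the nonconstant coefficients are random and hence translated; the constant one changes
  -- from `a` to `a'` by the choice of `Δ`.
  let e : Fin (deg N) → ZMod p := fun m => f (m + 1)
  rw [shareRandomly, shareRandomly, expect_map, expect_map]
  refine le_trans ?_ (expect_uniform_comp_equiv (Equiv.addRight e) _).le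
  refine expect_mono _ fun c => h _ _ ?_ ?_ ?_
  · exact (polyShares_sharesOf _ _).congr (if_pos rfl)
  · exact (polyShares_sharesOf _ _).congr (if_pos rfl)
  · convert hΔ.sameHeld_add _ using 1
    rw [← sharesOf_add]
    refine sharesOf_congr fun m hm => ?_
    rw [Pi.add_apply]
    rcases m with _ | m
    · simp [hf]
    · have : m < deg N := hm
      simp [this, e]

theorem adversaryLawOfSecrets_le (hQ : IsQuorum A) (K : ℕ) (view : List (Event p N))
    (q q' : TwoPairs (ZMod p)) (z) :
    adversaryLawOfSecrets A K view q z ≤ adversaryLawOfSecrets A K view q' z := by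
  classical
  rw [← expect_single (adversaryLawOfSecrets A K view q),
    ← expect_single (adversaryLawOfSecrets A K view q')]
  -- The four input sharings are coupled one after another; then the extended views agree and claim
  -- 3 applies to the gate.
  change expect (PMF.bind _ fun _ => PMF.bind _ fun _ => PMF.bind _ fun _ => PMF.bind _ fun _ => _) _
    ≤ expect (PMF.bind _ fun _ => PMF.bind _ fun _ => PMF.bind _ fun _ => PMF.bind _ fun _ => _) _
  simp only [expect_bind]
  refine expect_shareRandomly_le hQ _ _ fun v₁ v₁' h₁ h₁' e₁ => ?_
  refine expect_shareRandomly_le hQ _ _ fun v₂ v₂' h₂ h₂' e₂ => ?_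
  refine expect_shareRandomly_le hQ _ _ fun v₃ v₃' h₃ h₃' e₃ => ?_
  refine expect_shareRandomly_le hQ _ _ fun v₄ v₄' h₄ h₄' e₄ => ?_
  rw [sameHeld_iff] at e₁ e₂ e₃ e₄
  rw [e₁, e₂, e₃, e₄, adversaryLaw_eq hQ K _ (V := ⟨v₁, v₂, v₃, v₄⟩) (V' := ⟨v₁', v₂', v₃', v₄'⟩)
    (q := q) (q' := q') ⟨h₁, h₂, h₃, h₄⟩ ⟨h₁', h₂', h₃', h₄'⟩
    (by simp only [TwoPairs.map, e₁, e₂, e₃, e₄])]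

end GateAnalysis

end ObliviousGate

end

theorem mainTheorem7 (p N : ℕ) [Fact p.Prime] (hp : p ≠ 2) (hN : 0 < N) (hNp : N < p) :
    -- every run that does not fail outputs sharings of the pairs, in order or swapped
    (∀ A : ObliviousGate.Adversary p N, 6 * A.corrupt.card ≤ N →
      ∀ (K : ℕ) (view : List (ObliviousGate.Event p N))
        (q : ObliviousGate.TwoPairs (ZMod p))
        (V : ObliviousGate.TwoPairs (ObliviousGate.Shares p N)),
      ObliviousGate.AreSharings V q →
      ∀ out view', (some out, view') ∈ ((ObliviousGate.gate A K V).exec view).support →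
        (q.key₁.val ≤ q.key₂.val → ObliviousGate.AreSharings out q) ∧
        (¬ q.key₁.val ≤ q.key₂.val → ObliviousGate.AreSharings out q.swap)) ∧
    -- runs fail with probability tending to zero with the permitted number of attempts
    (∀ η : ENNReal, 0 < η → ∃ K₀ : ℕ, ∀ K, K₀ ≤ K →
      ∀ A : ObliviousGate.Adversary p N, 6 * A.corrupt.card ≤ N →
      ∀ (view : List (ObliviousGate.Event p N))
        (q : ObliviousGate.TwoPairs (ZMod p))
        (V : ObliviousGate.TwoPairs (ObliviousGate.Shares p N)),
      ObliviousGate.AreSharings V q →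
        (((ObliviousGate.gate A K V).exec view).map Prod.fst) none ≤ η) ∧
    -- the adversary learns nothing beyond the input shares of the dishonest parties
    (∀ A : ObliviousGate.Adversary p N, 6 * A.corrupt.card ≤ N →
      ∀ (K : ℕ) (view : List (ObliviousGate.Event p N))
        (q₁ q₂ : ObliviousGate.TwoPairs (ZMod p))
        (V₁ V₂ : ObliviousGate.TwoPairs (ObliviousGate.Shares p N)),
      ObliviousGate.AreSharings V₁ q₁ → ObliviousGate.AreSharings V₂ q₂ →
      V₁.map A.seeHeld = V₂.map A.seeHeld →
        ObliviousGate.adversaryLaw A K view V₁ = ObliviousGate.adversaryLaw A K view V₂) ∧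
    -- so its view has the same law for all secret inputs, in particular for exchanged input pairs
    (∀ A : ObliviousGate.Adversary p N, 6 * A.corrupt.card ≤ N →
      ∀ (K : ℕ) (view : List (ObliviousGate.Event p N))
        (q₁ q₂ : ObliviousGate.TwoPairs (ZMod p)),
        ObliviousGate.adversaryLawOfSecrets A K view q₁ =
          ObliviousGate.adversaryLawOfSecrets A K view q₂) := by
  have hQ : ∀ A : ObliviousGate.Adversary p N, 6 * A.corrupt.card ≤ N →
      ObliviousGate.IsQuorum A := fun A hA => ⟨hp, hNp, hN, hA⟩
  refine ⟨?_, ?_, ?_, ?_⟩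
  · intro A hA K view q V hV out view' hout
    -- For correctness only the finiteness of the cost bound matters, so it holds for every `K`,
    -- even where the failure bound exceeds `1`.
    exact (ObliviousGate.ensures_gate (hQ A hA) K hV).of_mem_support
      (ENNReal.mul_ne_top (by simp) (ObliviousGate.failBound_ne_top _ _)) hout
  · intro η hη
    obtain ⟨K₀, hK₀⟩ := ObliviousGate.exists_failBound_le p hη
    exact ⟨K₀, fun K hK A hA view q V hV =>
      ((ObliviousGate.ensures_gate (hQ A hA) K hV).fail_le view).trans (hK₀ K hK)⟩
  · intro A hA K view q₁ q₂ V₁ V₂ hV₁ hV₂ h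
    exact ObliviousGate.adversaryLaw_eq (hQ A hA) K view hV₁ hV₂ h
  · intro A hA K view q₁ q₂
    exact PMF.ext fun z => le_antisymm
      (ObliviousGate.adversaryLawOfSecrets_le (hQ A hA) K view q₁ q₂ z)
      (ObliviousGate.adversaryLawOfSecrets_le (hQ A hA) K view q₂ q₁ z)
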